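/- Let $n\ge 2$, let $\Omega\subset\mathbb{R}^n$ be a bounded open set and let $\Omega'\subset\mathbb{R}^n$ be a bounded domain (open and connected; locally Lipschitz if one likes, but no regularity of the boundary is required) with $\overline{\Omega}\subset\Omega'$. Let $T>0$. Let $\rho_0\in C^1(\mathbb{R}^n)$ satisfy $\rho_0>0$ on $\mathbb{R}^n$ and $\rho_0(x)=\overline\rho$ (a constant) for $x\in\mathbb{R}^n\setminus\Omega$. Let $p$ be a real function such that $x\mapsto p(\rho_0(x))$ is of class $C^1$ on $\mathbb{R}^n$ (for instance a pressure law $p\in C^1((0,\infty))$ with $p'>0$), and assume $$\int_\Omega p(\rho_0(x))\,dx=p(\overline\rho)\,|\Omega|.$$ For $\rho>0$, $m\in\mathbb{R}^n$ and a symmetric $n\times n$ matrix $U$ put $e(\rho,m,U):=\lambda_{\max}\big(\tfrac{m\otimes m}{\rho}-U\big)$, the largest eigenvalue. Then there exist a continuous (time-independent) field $\widetilde U$ on $\mathbb{R}^n$ with values in the symmetric trace-free $n\times n$ matrices, and a vector field $\widetilde m:\mathbb{R}^n\times\mathbb{R}\to\mathbb{R}^n$, of class $C^\infty$ in $x$ and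 linear in $t$, such that, with $\lambda(t):=\|e(\rho_0(\cdot),\widetilde m(\cdot,t),\widetilde U(\cdot))\|_{L^\infty(\Omega')}$: 1. $\operatorname{supp}\widetilde U\subset\Omega'$ and $\operatorname{supp}\widetilde m(\cdot,t)\subset\Omega'$ for every $t\in\mathbb{R}$; 2. $\operatorname{div}_x\widetilde m(\cdot,t)=0$ on $\mathbb{R}^n$ for every $t\in\mathbb{R}$; 3. for every open $J\subset\mathbb{R}$ and every continuous $\chi:J\to\mathbb{R}$ (for example $J=\mathbb{R}$ or $J=(0,T)$), with $q_0(x,t):=p(\rho_0(x))+\frac{\chi(t)}{n}$, $$\partial_t\widetilde m+\operatorname{div}_x\widetilde U+\nabla_x q_0=0$$ in the sense of distributions on $\mathbb{R}^n\times J$; 4. there are constants $C_1,C_2>0$ with $\lambda(t)\le C_1t^2+C_2$ for all $t\in\mathbb{R}$; 5. for every continuous $\chi:[0,T)\to\mathbb{R}$ with $\chi(t)>n\lambda(t)$ for all $t\in[0,T)$, $$e(\rho_0(x),\widetilde m(x,t),\widetilde U(x))<\frac{\chi(t)}{n}\qquad\text{for all }(x,t)\in\mathbb{R}^n\times[0,T).$$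 -/

import Mathlib

open MeasureTheory Set
open scoped ContDiff ENNReal

noncomputable section

/-- The largest eigenvalue of a real symmetric matrix (for a symmetric matrix of size `n ≥ 1` the
set of real eigenvalues is finite and nonempty, so the supremum is a maximum). -/
def lambdaMax {n : ℕ} (S : Matrix (Fin n) (Fin n) ℝ) : ℝ :=
  sSup {μ : ℝ | Module.End.HasEigenvalue (Matrix.toLin' S) μ}

/-- The generalized energy density `e(ρ, m, U) = λ_max (m ⊗ m / ρ - U)`. -/
def energyDensity {n : ℕ} (ρ : ℝ) (m : EuclideanSpace ℝ (Fin n))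
    (U : Matrix (Fin n) (Fin n) ℝ) : ℝ :=
  lambdaMax (ρ⁻¹ • Matrix.vecMulVec m.ofLp m.ofLp - U)

/-- The `L^∞(Ω')` norm of `x ↦ e(ρ₀(x), m(x, t), U(x))`, as an extended nonnegative number. -/
def energySup {n : ℕ} (Ω' : Set (EuclideanSpace ℝ (Fin n))) (ρ₀ : EuclideanSpace ℝ (Fin n) → ℝ)
    (m : EuclideanSpace ℝ (Fin n) → ℝ → EuclideanSpace ℝ (Fin n))
    (U : EuclideanSpace ℝ (Fin n) → Matrix (Fin n) (Fin n) ℝ) (t : ℝ) : ℝ≥0∞ :=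
  eLpNorm (fun x => energyDensity (ρ₀ x) (m x t) (U x)) ∞ (volume.restrict Ω')

/-- The classical divergence of a vector field on `ℝⁿ`. -/
def divergence {n : ℕ} (v : EuclideanSpace ℝ (Fin n) → EuclideanSpace ℝ (Fin n))
    (x : EuclideanSpace ℝ (Fin n)) : ℝ :=
  ∑ i, (fderiv ℝ v x (EuclideanSpace.single i 1)) i

/-- `∂ₜ m + div_x U + ∇_x q = 0` in the sense of distributions on `ℝⁿ × J`, for a
time-independent matrix field `U`: for every test field `φ ∈ C_c^∞(ℝⁿ × J; ℝⁿ)`,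
`∫∫ m · ∂ₜφ + ∑ᵢⱼ Uᵢⱼ ∂ⱼφᵢ + q div_x φ dx dt = 0`. -/
def WeakMomentumEquation {n : ℕ} (m : EuclideanSpace ℝ (Fin n) → ℝ → EuclideanSpace ℝ (Fin n))
    (U : EuclideanSpace ℝ (Fin n) → Matrix (Fin n) (Fin n) ℝ)
    (q : EuclideanSpace ℝ (Fin n) → ℝ → ℝ) (J : Set ℝ) : Prop :=
  ∀ φ : EuclideanSpace ℝ (Fin n) × ℝ → EuclideanSpace ℝ (Fin n),
    ContDiff ℝ ∞ φ → HasCompactSupport φ → tsupport φ ⊆ univ ×ˢ J →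
    ∫ z : EuclideanSpace ℝ (Fin n) × ℝ,
      (inner ℝ (m z.1 z.2) (fderiv ℝ φ z (0, 1))
        + ∑ i, ∑ j, U z.1 i j * (fderiv ℝ φ z (EuclideanSpace.single j 1, 0)) i
        + q z.1 z.2 * ∑ i, (fderiv ℝ φ z (EuclideanSpace.single i 1, 0)) i) = 0

end

/-!
The pressure deviation `f = p(ρ₀) - p(ρbar)` is a `C¹` function with zero mean and compact support
in the connected open set `Ω'`. If `W` is a compactly supported field with `div W = f`, then the
trace-free symmetric gradient `U` of `W`, suitably normalized (`stress`), satisfies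
`div U + ∇f = -w`, where `w` is a constant multiple of the divergence of the antisymmetric matrix
`curl W`. So `w` is solenoidal, and `m = t w` solves the momentum equation with stress `U` and
pressure `p(ρ₀)`; functions of time alone added to the pressure have no gradient. It remains to find
`W` of class `C¹` (so that `U` is continuous) whose curl is smooth (so that `m` is); this is
`exists_curlFree_add_smooth`.

That lemma rests on one computation, `sum_pd_sweep`: a function and any average of its translates
differ by the divergence of the field obtained by sweeping the function along the segments of
translation. Averaging `f` against a small radial bump `φ` gives a field `A` with
`div A = f - φ * f`, which is only `C¹` but curl-free, because `φ(y) y` is a gradient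
(`pd_sweep_comm`). In `φ * f` the translated function is the smooth bump: moving each bump
`φ(· - y)` to a common centre, along chains of balls in `Ω'`, shows that `φ * f`, whose mass is
zero, is the divergence of a smooth field `V` with compact support in `Ω'`
(`exists_isSmoothDivergence_mollify`). Then `W = A + V` has the smooth curl of `V`. No singular
kernel appears, and no regularity of the boundary of `Ω'` is used.

The distributional equation is obtained by integration by parts, where
`∫ ∂ᵢWⱼ ∂ⱼηᵢ = ∫ ∂ⱼWⱼ ∂ᵢηᵢ` (`integral_pd_mul_pd_comm`) stands in for the second derivatives that
`W` lacks (`integral_stress_balance`). The quadratic growth of `λ` comes from bounding eigenvalues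
by the matrix entries. For the pointwise inequality, the variational characterization makes the
largest eigenvalue lower semicontinuous, so that it is bounded everywhere on the open set `Ω'` by its
essential supremum.
-/

/-! ### Averages of translates -/

/-- A weighted average of translates is differentiated under the integral sign. Neither the
measure nor the weight is attached to the shifts `τ a`, so that both convolutions and averages
along segments are covered. -/
theorem hasFDerivAt_integral_translates {α E F : Type} [MeasurableSpace α]
    [NormedAddCommGroup E] [NormedSpace ℝ E] [MeasurableSpace E] [BorelSpace E]
    [FiniteDimensional ℝ E] [NormedAddCommGroup F] [NormedSpace ℝ F]
    {μ : Measure α} {w : α → ℝ} (hw : Integrable w μ) {τ : α → E} (hτ : Measurable τ)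
    {g : E → F} (hg : ContDiff ℝ 1 g) (hgc : HasCompactSupport g) (x : E) :
    HasFDerivAt (fun x => ∫ a, w a • g (x - τ a) ∂μ)
      (∫ a, w a • fderiv ℝ g (x - τ a) ∂μ) x := by
  obtain ⟨C₀, hC₀⟩ := hgc.exists_bound_of_continuous hg.continuous
  have hg' : Continuous (fderiv ℝ g) := hg.continuous_fderiv one_ne_zero
  obtain ⟨C₁, hC₁⟩ := (hgc.fderiv ℝ).exists_bound_of_continuous hg'
  have hm (x : E) : AEStronglyMeasurable (fun a => w a • g (x - τ a)) μ :=
    hw.1.smul ((hg.continuous.stronglyMeasurable.comp_measurable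
      (measurable_const.sub hτ)).aestronglyMeasurable)
  refine hasFDerivAt_integral_of_dominated_of_fderiv_le (s := univ)
    (F' := fun x a => w a • fderiv ℝ g (x - τ a)) (bound := fun a => ‖w a‖ * C₁) Filter.univ_mem
    (Filter.Eventually.of_forall hm) ?_ ?_ ?_ (hw.norm.mul_const _) ?_
  · refine (hw.norm.mul_const C₀).mono' (hm x) (Filter.Eventually.of_forall fun a => ?_)
    rw [norm_smul]
    exact mul_le_mul_of_nonneg_left (hC₀ _) (norm_nonneg _)
  · exact hw.1.smul ((hg'.stronglyMeasurable.comp_measurable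
      (measurable_const.sub hτ)).aestronglyMeasurable)
  · refine Filter.Eventually.of_forall fun a x _ => ?_
    rw [norm_smul]
    exact mul_le_mul_of_nonneg_left (hC₁ _) (norm_nonneg _)
  · refine Filter.Eventually.of_forall fun a x _ => ?_
    have h1 : HasFDerivAt (fun x => g (x - τ a)) (fderiv ℝ g (x - τ a)) x := by
      rw [hasFDerivAt_comp_sub]
      exact (hg.differentiable one_ne_zero _).hasFDerivAt
    exact h1.const_smul (w a)

theorem contDiff_integral_translates {α E F : Type} [MeasurableSpace α]
    [NormedAddCommGroup E] [NormedSpace ℝ E] [MeasurableSpace E] [BorelSpace E]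
    [FiniteDimensional ℝ E] [NormedAddCommGroup F] [NormedSpace ℝ F]
    {μ : Measure α} {w : α → ℝ} (hw : Integrable w μ) {τ : α → E} (hτ : Measurable τ)
    {g : E → F} (k : ℕ) (hg : ContDiff ℝ (k + 1) g) (hgc : HasCompactSupport g) :
    ContDiff ℝ (k + 1) (fun x => ∫ a, w a • g (x - τ a) ∂μ) := by
  have key : ∀ {F : Type} [NormedAddCommGroup F] [NormedSpace ℝ F] {g : E → F},
      ContDiff ℝ 1 g → HasCompactSupport g →
      fderiv ℝ (fun x => ∫ a, w a • g (x - τ a) ∂μ) =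
        fun x => ∫ a, w a • fderiv ℝ g (x - τ a) ∂μ := fun hg hgc =>
    funext fun x => (hasFDerivAt_integral_translates hw hτ hg hgc x).fderiv
  induction k generalizing F with
  | zero =>
    have hg1 : ContDiff ℝ 1 g := by simpa using hg
    simp only [Nat.cast_zero, zero_add]
    refine contDiff_one_iff_fderiv.2 ⟨fun x =>
      (hasFDerivAt_integral_translates hw hτ hg1 hgc x).differentiableAt, ?_⟩
    rw [key hg1 hgc]
    have hg' : Continuous (fderiv ℝ g) := hg1.continuous_fderiv one_ne_zero
    obtain ⟨C₁, hC₁⟩ := (hgc.fderiv ℝ).exists_bound_of_continuous hg'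
    refine continuous_of_dominated (bound := fun a => ‖w a‖ * C₁) (fun x => ?_) (fun x => ?_)
      (hw.norm.mul_const _) (Filter.Eventually.of_forall fun a => ?_)
    · exact hw.1.smul ((hg'.stronglyMeasurable.comp_measurable
        (measurable_const.sub hτ)).aestronglyMeasurable)
    · refine Filter.Eventually.of_forall fun a => ?_
      rw [norm_smul]
      exact mul_le_mul_of_nonneg_left (hC₁ _) (norm_nonneg _)
    · fun_prop
  | succ k ih =>
    have hg1 : ContDiff ℝ 1 g := hg.of_le (by exact_mod_cast Nat.le_add_left 1 (k + 1))
    rw [contDiff_succ_iff_fderiv] at hg ⊢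
    refine ⟨fun x => (hasFDerivAt_integral_translates hw hτ hg1 hgc x).differentiableAt,
      fun h => absurd h (by exact_mod_cast WithTop.coe_ne_top), ?_⟩
    rw [key hg1 hgc]
    have := ih (F := E →L[ℝ] F) (g := fderiv ℝ g) (by exact_mod_cast hg.2.2) (hgc.fderiv ℝ)
    exact_mod_cast this

/-! ### Partial derivatives -/

/-- The partial derivative `∂ᵢ g` of a scalar function on `ℝⁿ`. -/
noncomputable def pd {n : ℕ} (i : Fin n) (g : EuclideanSpace ℝ (Fin n) → ℝ)
    (x : EuclideanSpace ℝ (Fin n)) : ℝ :=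
  fderiv ℝ g x (EuclideanSpace.single i 1)

section PartialDerivatives

variable {n : ℕ} {g h : EuclideanSpace ℝ (Fin n) → ℝ}

theorem ContDiff.pd_succ {k : ℕ∞} (hg : ContDiff ℝ (k + 1) g) (i : Fin n) :
    ContDiff ℝ k (pd i g) :=
  (hg.fderiv_right le_rfl).clm_apply contDiff_const

theorem ContDiff.pd_infty (hg : ContDiff ℝ ∞ g) (i : Fin n) : ContDiff ℝ ∞ (pd i g) :=
  ContDiff.pd_succ (k := ⊤) (hg.of_le (by simp)) i

theorem ContDiff.continuous_pd (hg : ContDiff ℝ 1 g) (i : Fin n) : Continuous (pd i g) :=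
  (hg.continuous_fderiv one_ne_zero).clm_apply continuous_const

theorem tsupport_pd_subset (i : Fin n) (g : EuclideanSpace ℝ (Fin n) → ℝ) :
    tsupport (pd i g) ⊆ tsupport g :=
  tsupport_fderiv_apply_subset ℝ _

theorem HasCompactSupport.pd (hg : HasCompactSupport g) (i : Fin n) :
    HasCompactSupport (pd i g) :=
  hg.fderiv_apply ℝ _

theorem pd_add (hg : Differentiable ℝ g) (hh : Differentiable ℝ h) (i : Fin n) :
    pd i (fun x => g x + h x) = fun x => pd i g x + pd i h x := by
  funext x
  simp [pd, fderiv_fun_add (hg x) (hh x)]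

theorem pd_const_mul (hg : Differentiable ℝ g) (c : ℝ) (i : Fin n) :
    pd i (fun x => c * g x) = fun x => c * pd i g x := by
  funext x
  simp [pd, fderiv_const_mul (hg x)]

theorem pd_sum {ι : Type*} (s : Finset ι) {f : ι → EuclideanSpace ℝ (Fin n) → ℝ}
    (hf : ∀ j, Differentiable ℝ (f j)) (i : Fin n) :
    pd i (fun x => ∑ j ∈ s, f j x) = fun x => ∑ j ∈ s, pd i (f j) x := by
  funext x
  simp [pd, fderiv_fun_sum (fun j _ => hf j x)]

theorem pd_comm (hg : ContDiff ℝ 2 g) (i j : Fin n) : pd i (pd j g) = pd j (pd i g) := by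
  funext x
  have hd : DifferentiableAt ℝ (fderiv ℝ g) x :=
    (hg.fderiv_right (m := 1) (by norm_num)).differentiable one_ne_zero x
  have hs : IsSymmSndFDerivAt ℝ g x := hg.contDiffAt.isSymmSndFDerivAt (by simp)
  have e (i j : Fin n) : pd i (pd j g) x =
      fderiv ℝ (fderiv ℝ g) x (EuclideanSpace.single i 1) (EuclideanSpace.single j 1) := by
    have : pd j g = fun y => fderiv ℝ g y (EuclideanSpace.single j 1) := rfl
    rw [this, pd, fderiv_clm_apply hd (differentiableAt_const _)]
    simp
  rw [e, e, hs]

theorem integral_mul_pd (hg : ContDiff ℝ 1 g) (hh : ContDiff ℝ 1 h) (hc : HasCompactSupport h)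
    (i : Fin n) : ∫ x, g x * pd i h x = -∫ x, pd i g x * h x := by
  have h1 := hg.continuous_pd i
  have h2 := hh.continuous_pd i
  refine integral_mul_fderiv_eq_neg_fderiv_mul_of_integrable ?_ ?_ ?_
    (fun x _ => hg.differentiable one_ne_zero x) (fun x _ => hh.differentiable one_ne_zero x)
  · exact (h1.mul hh.continuous).integrable_of_hasCompactSupport hc.mul_left
  · exact (hg.continuous.mul h2).integrable_of_hasCompactSupport (hc.pd i).mul_left
  · exact (hg.continuous.mul hh.continuous).integrable_of_hasCompactSupport hc.mul_left

/-- Two integrations by parts exchange the directions of the derivatives in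
`∫ ∂ᵢg ∂ⱼh`; only one of the two functions needs a second derivative. -/
theorem integral_pd_mul_pd_comm (hg : ContDiff ℝ 1 g) (hh : ContDiff ℝ 2 h)
    (hc : HasCompactSupport h) (i j : Fin n) :
    ∫ x, pd i g x * pd j h x = ∫ x, pd j g x * pd i h x := by
  have hk (k : Fin n) : ContDiff ℝ 1 (pd k h) := ContDiff.pd_succ (k := 1) (by exact_mod_cast hh) k
  have e1 := integral_mul_pd hg (hk j) (hc.pd j) i
  have e2 := integral_mul_pd hg (hk i) (hc.pd i) j
  rw [pd_comm hh i j] at e1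
  linarith

end PartialDerivatives

/-! ### The divergence of a translation homotopy -/

section Homotopy

variable {n : ℕ} {α : Type} [MeasurableSpace α]

/-- The `i`-th component of the field `x ↦ ∫ w(a) ∫₀¹ τ(a) g(x - s τ(a)) ds dν(a)`, obtained by
sweeping `g` along the segments from `0` to `τ(a)`. -/
noncomputable def sweep (ν : Measure α) (w : α → ℝ) (τ : α → EuclideanSpace ℝ (Fin n))
    (g : EuclideanSpace ℝ (Fin n) → ℝ) (i : Fin n) (x : EuclideanSpace ℝ (Fin n)) : ℝ :=
  ∫ z : α × ℝ, (w z.1 * τ z.1 i) • g (x - z.2 • τ z.1) ∂(ν.prod (volume.restrict (Icc 0 1)))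

variable {ν : Measure α} {w : α → ℝ} {τ : α → EuclideanSpace ℝ (Fin n)}
  {g : EuclideanSpace ℝ (Fin n) → ℝ} {R : ℝ}

theorem integrable_mul_coord (hw : Integrable w ν) (hτ : Measurable τ)
    (hR : ∀ a, w a ≠ 0 → ‖τ a‖ ≤ R) (i : Fin n) : Integrable (fun a => w a * τ a i) ν := by
  refine (hw.norm.mul_const R).mono' (hw.1.mul ?_) (Filter.Eventually.of_forall fun a => ?_)
  · exact ((EuclideanSpace.proj i : EuclideanSpace ℝ (Fin n) →L[ℝ] ℝ).continuous.measurable.comp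
      hτ).aestronglyMeasurable
  · rw [norm_mul]
    by_cases h : w a = 0
    · simp [h]
    · exact mul_le_mul_of_nonneg_left ((PiLp.norm_apply_le _ i).trans (hR a h)) (norm_nonneg _)

theorem tsupport_sweep_subset {L : Set (EuclideanSpace ℝ (Fin n))} (hL : IsClosed L)
    (h : ∀ a, w a ≠ 0 → ∀ s ∈ Icc (0 : ℝ) 1, ∀ z ∈ tsupport g, z + s • τ a ∈ L) (i : Fin n) :
    tsupport (sweep ν w τ g i) ⊆ L := by
  refine closure_minimal (fun x hx => ?_) hL
  by_contra hxL
  refine hx ?_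
  have hae : ∀ᵐ z : α × ℝ ∂(ν.prod (volume.restrict (Icc 0 1))), z.2 ∈ Icc (0 : ℝ) 1 :=
    (Measure.quasiMeasurePreserving_snd (μ := ν) (ν := volume.restrict (Icc (0:ℝ) 1))).ae
      (ae_restrict_mem measurableSet_Icc)
  refine integral_eq_zero_of_ae ?_
  filter_upwards [hae] with z hz
  by_cases hwz : w z.1 = 0
  · simp [hwz]
  · have : x - z.2 • τ z.1 ∉ tsupport g := fun hmem =>
      hxL (by simpa using h z.1 hwz z.2 hz _ hmem)
    simp [image_eq_zero_of_notMem_tsupport this]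

theorem integrable_sweep_weight (hw : Integrable w ν) (hτ : Measurable τ)
    (hR : ∀ a, w a ≠ 0 → ‖τ a‖ ≤ R) (i : Fin n) :
    Integrable (fun z : α × ℝ => w z.1 * τ z.1 i) (ν.prod (volume.restrict (Icc 0 1))) :=
  (integrable_mul_coord hw hτ hR i).comp_fst _

theorem measurable_sweep_shift (hτ : Measurable τ) :
    Measurable (fun z : α × ℝ => z.2 • τ z.1) :=
  measurable_snd.smul (hτ.comp measurable_fst)

theorem contDiff_sweep (hw : Integrable w ν) (hτ : Measurable τ)
    (hR : ∀ a, w a ≠ 0 → ‖τ a‖ ≤ R) (k : ℕ) (hg : ContDiff ℝ (k + 1) g)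
    (hgc : HasCompactSupport g) (i : Fin n) : ContDiff ℝ (k + 1) (sweep ν w τ g i) :=
  contDiff_integral_translates (integrable_sweep_weight hw hτ hR i) (measurable_sweep_shift hτ)
    k hg hgc

theorem contDiff_infty_sweep (hw : Integrable w ν) (hτ : Measurable τ)
    (hR : ∀ a, w a ≠ 0 → ‖τ a‖ ≤ R) (hg : ContDiff ℝ ∞ g)
    (hgc : HasCompactSupport g) (i : Fin n) : ContDiff ℝ ∞ (sweep ν w τ g i) :=
  contDiff_infty.2 fun k => (contDiff_sweep hw hτ hR k
    (hg.of_le (by exact_mod_cast le_top)) hgc i).of_le (by exact_mod_cast Nat.le_succ k)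

theorem pd_sweep (hw : Integrable w ν) (hτ : Measurable τ)
    (hR : ∀ a, w a ≠ 0 → ‖τ a‖ ≤ R) (hg : ContDiff ℝ 1 g)
    (hgc : HasCompactSupport g) (i j : Fin n) (x : EuclideanSpace ℝ (Fin n)) :
    Integrable (fun z : α × ℝ => (w z.1 * τ z.1 i) * pd j g (x - z.2 • τ z.1))
      (ν.prod (volume.restrict (Icc 0 1))) ∧
    pd j (sweep ν w τ g i) x =
      ∫ z : α × ℝ, (w z.1 * τ z.1 i) * pd j g (x - z.2 • τ z.1)
        ∂(ν.prod (volume.restrict (Icc 0 1))) := by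
  have hW := integrable_sweep_weight hw hτ hR i
  have hT := measurable_sweep_shift hτ
  have hd := hasFDerivAt_integral_translates hW hT hg hgc x
  have hg' : Continuous (fderiv ℝ g) := hg.continuous_fderiv one_ne_zero
  obtain ⟨C, hC⟩ := (hgc.fderiv ℝ).exists_bound_of_continuous hg'
  have hint : Integrable (fun z : α × ℝ => (w z.1 * τ z.1 i) • fderiv ℝ g (x - z.2 • τ z.1))
      (ν.prod (volume.restrict (Icc 0 1))) := by
    refine (hW.norm.mul_const C).mono' (hW.1.smul ((hg'.stronglyMeasurable.comp_measurable
      (measurable_const.sub hT)).aestronglyMeasurable)) (Filter.Eventually.of_forall fun a => ?_)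
    rw [norm_smul]
    exact mul_le_mul_of_nonneg_left (hC _) (norm_nonneg _)
  refine ⟨hint.apply_continuousLinearMap (EuclideanSpace.single j 1), ?_⟩
  have e : sweep ν w τ g i = fun x => ∫ z : α × ℝ, (w z.1 * τ z.1 i) • g (x - z.2 • τ z.1)
      ∂(ν.prod (volume.restrict (Icc 0 1))) := rfl
  rw [pd, e, hd.fderiv, ContinuousLinearMap.integral_apply hint]
  rfl

theorem fderiv_eq_sum_pd (g : EuclideanSpace ℝ (Fin n) → ℝ) (x v : EuclideanSpace ℝ (Fin n)) :
    fderiv ℝ g x v = ∑ i, v i * pd i g x := by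
  have hv : v = ∑ i, v i • EuclideanSpace.single i (1 : ℝ) := by
    ext j
    simp [Pi.single_apply]
  conv_lhs => rw [hv]
  simp [pd]

theorem integral_fderiv_segment (hg : ContDiff ℝ 1 g) (x v : EuclideanSpace ℝ (Fin n)) :
    ∫ s in Icc (0 : ℝ) 1, fderiv ℝ g (x - s • v) v = g x - g (x - v) := by
  rw [integral_Icc_eq_integral_Ioc, ← intervalIntegral.integral_of_le zero_le_one]
  have h1 (s : ℝ) : HasDerivAt (fun s : ℝ => -g (x - s • v)) (fderiv ℝ g (x - s • v) v) s := by
    have h2 : HasDerivAt (fun s : ℝ => x - s • v) (-v) s := by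
      simpa using ((hasDerivAt_id s).smul_const v).const_sub x
    have h3 : HasDerivAt (fun s : ℝ => -g (x - s • v)) (-(fderiv ℝ g (x - s • v) (-v))) s :=
      ((hg.differentiable one_ne_zero (x - s • v)).hasFDerivAt.comp_hasDerivAt s h2).neg
    rwa [map_neg, neg_neg] at h3
  have hg' : Continuous (fderiv ℝ g) := hg.continuous_fderiv one_ne_zero
  rw [intervalIntegral.integral_eq_sub_of_hasDerivAt (fun s _ => h1 s)
    (Continuous.intervalIntegrable (by fun_prop) _ _)]
  simp only [one_smul, zero_smul, sub_zero]
  ring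

variable [SFinite ν]

/-- The fundamental theorem of calculus along the segments: the swept field is a primitive, for
the divergence, of the difference between `g` and the average of its translates. -/
theorem sum_pd_sweep (hw : Integrable w ν) (hτ : Measurable τ)
    (hR : ∀ a, w a ≠ 0 → ‖τ a‖ ≤ R) (hg : ContDiff ℝ 1 g)
    (hgc : HasCompactSupport g) (x : EuclideanSpace ℝ (Fin n)) :
    ∑ i, pd i (sweep ν w τ g i) x = ∫ a, w a * (g x - g (x - τ a)) ∂ν := by
  have h := fun i => pd_sweep hw hτ hR hg hgc i i x
  rw [Finset.sum_congr rfl fun i _ => (h i).2, ← integral_finsetSum _ fun i _ => (h i).1,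
    integral_prod _ (integrable_finsetSum _ fun i _ => (h i).1)]
  refine integral_congr_ae (Filter.Eventually.of_forall fun a => ?_)
  simp only
  rw [← integral_fderiv_segment hg, ← integral_const_mul]
  refine integral_congr_ae (Filter.Eventually.of_forall fun s => ?_)
  simp only [fderiv_eq_sum_pd, Finset.mul_sum, mul_assoc]

end Homotopy

/-! ### Divergences of compactly supported smooth fields -/

section SmoothDivergence

variable {n : ℕ} {O : Set (EuclideanSpace ℝ (Fin n))}

/-- `g` is the divergence of a smooth vector field with compact support in `O`; the field is given
by its components. -/
def IsSmoothDivergence (O : Set (EuclideanSpace ℝ (Fin n)))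
    (g : EuclideanSpace ℝ (Fin n) → ℝ) : Prop :=
  ∃ V : Fin n → EuclideanSpace ℝ (Fin n) → ℝ, (∀ i, ContDiff ℝ ∞ (V i)) ∧
    (∀ i, HasCompactSupport (V i)) ∧ (∀ i, tsupport (V i) ⊆ O) ∧ ∀ x, g x = ∑ i, pd i (V i) x

theorem IsSmoothDivergence.zero : IsSmoothDivergence O (fun _ => 0) :=
  ⟨fun _ _ => 0, fun _ => contDiff_const, fun _ => HasCompactSupport.zero,
    fun _ => by simp [tsupport], fun x => by simp [pd]⟩

theorem IsSmoothDivergence.add {g h : EuclideanSpace ℝ (Fin n) → ℝ}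
    (hg : IsSmoothDivergence O g) (hh : IsSmoothDivergence O h) :
    IsSmoothDivergence O (fun x => g x + h x) := by
  obtain ⟨V, hV, hVc, hVs, hVd⟩ := hg
  obtain ⟨W, hW, hWc, hWs, hWd⟩ := hh
  refine ⟨fun i x => V i x + W i x, fun i => (hV i).add (hW i), fun i => (hVc i).add (hWc i),
    fun i => (tsupport_add _ _).trans (union_subset (hVs i) (hWs i)), fun x => ?_⟩
  simp only
  rw [hVd, hWd, ← Finset.sum_add_distrib]
  refine Finset.sum_congr rfl fun i _ => ?_
  rw [pd_add ((hV i).differentiable (by simp)) ((hW i).differentiable (by simp))]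

theorem IsSmoothDivergence.const_mul {g : EuclideanSpace ℝ (Fin n) → ℝ}
    (hg : IsSmoothDivergence O g) (c : ℝ) : IsSmoothDivergence O (fun x => c * g x) := by
  obtain ⟨V, hV, hVc, hVs, hVd⟩ := hg
  refine ⟨fun i x => c * V i x, fun i => contDiff_const.mul (hV i), fun i => (hVc i).mul_left,
    fun i => (tsupport_mul_subset_right).trans (hVs i), fun x => ?_⟩
  simp only
  rw [hVd, Finset.mul_sum]
  refine Finset.sum_congr rfl fun i _ => ?_
  rw [pd_const_mul ((hV i).differentiable (by simp))]

theorem tsupport_comp_sub_subset {φ : EuclideanSpace ℝ (Fin n) → ℝ} {ε : ℝ}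
    (hφ : tsupport φ ⊆ Metric.closedBall 0 ε) (a : EuclideanSpace ℝ (Fin n)) :
    tsupport (fun x => φ (x - a)) ⊆ Metric.closedBall a ε := by
  refine closure_minimal (fun x hx => ?_) Metric.isClosed_closedBall
  have := hφ (subset_tsupport _ (show x - a ∈ Function.support φ from hx))
  rwa [Metric.mem_closedBall, dist_eq_norm, ← mem_closedBall_zero_iff]

/-- Within a ball contained in `O`, an average of translates of a small bump `φ` differs from a
single translate of `φ` with the same mass by the divergence of a field supported in that ball.
The measure `ν` is arbitrary, so that point masses are included. -/
theorem isSmoothDivergence_average_of_closedBall {ν : Measure (EuclideanSpace ℝ (Fin n))}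
    [SFinite ν] {a : EuclideanSpace ℝ (Fin n)} {r ε : ℝ}
    (hO : Metric.closedBall a (r + ε) ⊆ O) {φ : EuclideanSpace ℝ (Fin n) → ℝ}
    (hφ : ContDiff ℝ ∞ φ) (hφs : tsupport φ ⊆ Metric.closedBall 0 ε)
    {w : EuclideanSpace ℝ (Fin n) → ℝ} (hw : Integrable w ν)
    (hwr : ∀ y, w y ≠ 0 → y ∈ Metric.closedBall a r) :
    IsSmoothDivergence O (fun x => ∫ y, w y * (φ (x - a) - φ (x - y)) ∂ν) := by
  have hg : ContDiff ℝ ∞ (fun x => φ (x - a)) := hφ.comp (contDiff_id.sub contDiff_const)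
  have hgs := tsupport_comp_sub_subset hφs a
  have hgc : HasCompactSupport (fun x => φ (x - a)) :=
    (isCompact_closedBall a ε).of_isClosed_subset (isClosed_tsupport _) hgs
  have hτ : Measurable (fun y : EuclideanSpace ℝ (Fin n) => y - a) := measurable_id.sub_const a
  have hR : ∀ y, w y ≠ 0 → ‖y - a‖ ≤ r := fun y hy => by
    simpa [dist_eq_norm] using hwr y hy
  have hsub (i : Fin n) : tsupport (sweep ν w (fun y => y - a) (fun x => φ (x - a)) i) ⊆
      Metric.closedBall a (r + ε) := by
    refine tsupport_sweep_subset Metric.isClosed_closedBall (fun y hy s hs z hz => ?_) i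
    have h1 : ‖z - a‖ ≤ ε := by simpa [dist_eq_norm] using hgs hz
    have h2 : ‖s • (y - a)‖ ≤ r := by
      rw [norm_smul, Real.norm_of_nonneg hs.1]
      exact (mul_le_of_le_one_left (norm_nonneg _) hs.2).trans (hR y hy)
    rw [Metric.mem_closedBall, dist_eq_norm, add_sub_right_comm]
    linarith [norm_add_le (z - a) (s • (y - a))]
  refine ⟨sweep ν w (fun y => y - a) (fun x => φ (x - a)),
    contDiff_infty_sweep hw hτ hR hg hgc, fun i => ?_, fun i => (hsub i).trans hO, fun x => ?_⟩
  · exact (isCompact_closedBall a (r + ε)).of_isClosed_subset (isClosed_tsupport _) (hsub i)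
  · rw [sum_pd_sweep hw hτ hR (hg.of_le (by simp)) hgc]
    simp only [sub_sub, sub_add_cancel]

/-- In a connected open set, small bumps around any two points differ by a divergence. -/
theorem exists_isSmoothDivergence_sub (hO : IsOpen O) (hOc : IsPreconnected O)
    {a b : EuclideanSpace ℝ (Fin n)} (ha : a ∈ O) (hb : b ∈ O) :
    ∃ ε > 0, ∀ φ : EuclideanSpace ℝ (Fin n) → ℝ, ContDiff ℝ ∞ φ →
      tsupport φ ⊆ Metric.closedBall 0 ε →
      IsSmoothDivergence O (fun x => φ (x - a) - φ (x - b)) := by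
  refine hOc.induction₂ (fun a b => ∃ ε > 0, ∀ φ : EuclideanSpace ℝ (Fin n) → ℝ,
    ContDiff ℝ ∞ φ → tsupport φ ⊆ Metric.closedBall 0 ε →
      IsSmoothDivergence O (fun x => φ (x - a) - φ (x - b))) ?_ ?_ ?_ ha hb
  · intro x hx
    obtain ⟨r, hr, hrO⟩ := Metric.nhds_basis_closedBall.mem_iff.1 (hO.mem_nhds hx)
    filter_upwards [nhdsWithin_le_nhds (Metric.closedBall_mem_nhds x (half_pos hr))] with y hy
    refine ⟨r / 2, half_pos hr, fun φ hφ hφs => ?_⟩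
    have := isSmoothDivergence_average_of_closedBall (O := O) (ν := Measure.dirac y) (a := x)
      (r := r / 2) (by rwa [add_halves]) hφ hφs
      (w := (Metric.closedBall x (r / 2)).indicator fun _ => 1)
      ((integrable_const 1).indicator Metric.isClosed_closedBall.measurableSet)
      (fun z hz => mem_of_indicator_ne_zero hz)
    convert this using 2 with z
    rw [integral_dirac, indicator_of_mem hy, one_mul]
  · rintro x y z - - - ⟨ε₁, h₁, H₁⟩ ⟨ε₂, h₂, H₂⟩
    refine ⟨min ε₁ ε₂, lt_min h₁ h₂, fun φ hφ hφs => ?_⟩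
    convert (H₁ φ hφ (hφs.trans (Metric.closedBall_subset_closedBall (min_le_left _ _)))).add
      (H₂ φ hφ (hφs.trans (Metric.closedBall_subset_closedBall (min_le_right _ _)))) using 2
    ring
  · rintro x y - - ⟨ε, h, H⟩
    refine ⟨ε, h, fun φ hφ hφs => ?_⟩
    convert (H φ hφ hφs).const_mul (-1) using 2
    ring

/-- Mollification over a compact subset `K` of a connected open set `O` reduces, modulo
divergences, to a single bump carrying the total mass. -/
theorem exists_isSmoothDivergence_mollify (hO : IsOpen O) (hOc : IsPreconnected O)
    {K : Set (EuclideanSpace ℝ (Fin n))} (hK : IsCompact K) (hKO : K ⊆ O)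
    {b : EuclideanSpace ℝ (Fin n)} (hb : b ∈ O) :
    ∃ ε > 0, ∀ φ : EuclideanSpace ℝ (Fin n) → ℝ, ContDiff ℝ ∞ φ →
      tsupport φ ⊆ Metric.closedBall 0 ε →
      ∀ w : EuclideanSpace ℝ (Fin n) → ℝ, Integrable w → (∀ y, w y ≠ 0 → y ∈ K) →
      IsSmoothDivergence O (fun x => ∫ y, w y * (φ (x - b) - φ (x - y))) := by
  -- Splitting the weight between two sets needs measurability, hence the measurable superset.
  suffices H : ∃ S, MeasurableSet S ∧ K ⊆ S ∧ ∃ ε > 0, ∀ φ : EuclideanSpace ℝ (Fin n) → ℝ,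
      ContDiff ℝ ∞ φ → tsupport φ ⊆ Metric.closedBall 0 ε →
      ∀ w : EuclideanSpace ℝ (Fin n) → ℝ, Integrable w → (∀ y, w y ≠ 0 → y ∈ S) →
      IsSmoothDivergence O (fun x => ∫ y, w y * (φ (x - b) - φ (x - y))) by
    obtain ⟨S, -, hKS, ε, hε, H⟩ := H
    exact ⟨ε, hε, fun φ hφ hφs w hw hwK => H φ hφ hφs w hw fun y hy => hKS (hwK y hy)⟩
  have hint {φ : EuclideanSpace ℝ (Fin n) → ℝ} {ε : ℝ} (hφ : ContDiff ℝ ∞ φ)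
      (hφs : tsupport φ ⊆ Metric.closedBall 0 ε) {w : EuclideanSpace ℝ (Fin n) → ℝ}
      (hw : Integrable w) (a x : EuclideanSpace ℝ (Fin n)) :
      Integrable (fun y => w y * (φ (x - a) - φ (x - y))) := by
    have hφc : HasCompactSupport φ :=
      (isCompact_closedBall 0 ε).of_isClosed_subset (isClosed_tsupport _) hφs
    obtain ⟨C, hC⟩ := hφc.exists_bound_of_continuous hφ.continuous
    have hcont := hφ.continuous
    refine (hw.norm.mul_const (C + C)).mono' (hw.1.mul (Continuous.aestronglyMeasurable
      (by fun_prop))) (Filter.Eventually.of_forall fun y => ?_)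
    rw [norm_mul]
    exact mul_le_mul_of_nonneg_left ((norm_sub_le _ _).trans (add_le_add (hC _) (hC _)))
      (norm_nonneg _)
  refine hK.induction_on (p := fun K => ∃ S, MeasurableSet S ∧ K ⊆ S ∧ ∃ ε > 0,
      ∀ φ : EuclideanSpace ℝ (Fin n) → ℝ, ContDiff ℝ ∞ φ →
      tsupport φ ⊆ Metric.closedBall 0 ε →
      ∀ w : EuclideanSpace ℝ (Fin n) → ℝ, Integrable w → (∀ y, w y ≠ 0 → y ∈ S) →
      IsSmoothDivergence O (fun x => ∫ y, w y * (φ (x - b) - φ (x - y)))) ?_ ?_ ?_ ?_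
  · refine ⟨∅, MeasurableSet.empty, subset_rfl, 1, one_pos, fun φ _ _ w _ hw0 => ?_⟩
    have : w = fun _ => 0 := funext fun y => by_contra fun h => hw0 y h
    simpa [this] using IsSmoothDivergence.zero
  · rintro s t hst ⟨S, hS, htS, H⟩
    exact ⟨S, hS, hst.trans htS, H⟩
  · rintro s t ⟨S, hS, hsS, ε₁, h₁, H₁⟩ ⟨S', hS', htS', ε₂, h₂, H₂⟩
    refine ⟨S ∪ S', hS.union hS', union_subset_union hsS htS', min ε₁ ε₂, lt_min h₁ h₂,
      fun φ hφ hφs w hw hwS => ?_⟩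
    have hA : Integrable (S.indicator w) := hw.indicator hS
    have hB : Integrable (Sᶜ.indicator w) := hw.indicator hS.compl
    have H1 := H₁ φ hφ (hφs.trans (Metric.closedBall_subset_closedBall (min_le_left _ _)))
      (S.indicator w) hA (fun y hy => (indicator_apply_ne_zero.1 hy).1)
    have H2 := H₂ φ hφ (hφs.trans (Metric.closedBall_subset_closedBall (min_le_right _ _)))
      (Sᶜ.indicator w) hB (fun y hy => by
        obtain ⟨h3, h4⟩ := indicator_apply_ne_zero.1 hy
        exact (hwS y h4).resolve_left h3)
    convert H1.add H2 using 2 with x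
    rw [← integral_add (hint hφ hφs hA b x) (hint hφ hφs hB b x)]
    congr 1 with y
    rw [← add_mul, indicator_self_add_compl_apply]
  · intro a ha
    obtain ⟨r, hr, hrO⟩ := Metric.nhds_basis_closedBall.mem_iff.1 (hO.mem_nhds (hKO ha))
    obtain ⟨ε, hε, H⟩ := exists_isSmoothDivergence_sub hO hOc hb (hKO ha)
    refine ⟨Metric.closedBall a (r / 2), nhdsWithin_le_nhds
      (Metric.closedBall_mem_nhds a (half_pos hr)), Metric.closedBall a (r / 2),
      Metric.isClosed_closedBall.measurableSet, subset_rfl, min ε (r / 2),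
      lt_min hε (half_pos hr), fun φ hφ hφs w hw hwS => ?_⟩
    have h1 := isSmoothDivergence_average_of_closedBall (O := O) (ν := volume) (a := a)
      (r := r / 2) (ε := r / 2)
      (by rwa [add_halves]) hφ (hφs.trans (Metric.closedBall_subset_closedBall (min_le_right _ _)))
      hw hwS
    have h2 := (H φ hφ (hφs.trans (Metric.closedBall_subset_closedBall
      (min_le_left _ _)))).const_mul (∫ y, w y)
    convert h1.add h2 using 2 with x
    rw [← integral_mul_const, ← integral_add (hint hφ hφs hw a x) (hw.mul_const _)]
    congr 1 with y
    ring

end SmoothDivergence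

/-! ### Splitting a density into a curl-free and a smooth divergence -/

section Splitting

variable {n : ℕ}

/-- Radial mollifiers `φ` at scale `ε`, together with a compactly supported potential `Φ` of the
field `y ↦ φ(y) y`. -/
theorem exists_radial_mollifier {ε : ℝ} (hε : 0 < ε) :
    ∃ φ Φ : EuclideanSpace ℝ (Fin n) → ℝ, ContDiff ℝ ∞ φ ∧ ContDiff ℝ ∞ Φ ∧
      tsupport φ ⊆ Metric.closedBall 0 ε ∧ tsupport Φ ⊆ Metric.closedBall 0 ε ∧
      (∀ i y, pd i Φ y = φ y * y i) ∧ ∫ y, φ y = 1 := by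
  -- The potential is `Φ = G(|y|² / ε²)` up to a factor; `G` is nondecreasing, so that `φ`, which is
  -- proportional to `G'(|y|² / ε²)`, is nonnegative with a positive integral.
  set G : ℝ → ℝ := fun s => -expNegInvGlue (1 - s) with hG
  have hGs : ContDiff ℝ ∞ G := (expNegInvGlue.contDiff.comp (contDiff_const.sub contDiff_id)).neg
  have hGd (s : ℝ) : HasDerivAt G (((1 - s)⁻¹) ^ 2 * expNegInvGlue (1 - s)) s := by
    have h1 := expNegInvGlue.hasDerivAt_polynomial_eval_inv_mul 1 (1 - s)
    simp only [Polynomial.eval_one, one_mul, Polynomial.derivative_one, sub_zero, mul_one,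
      Polynomial.eval_pow, Polynomial.eval_X] at h1
    have h2 : HasDerivAt (fun s : ℝ => 1 - s) (-1) s := by
      simpa using (hasDerivAt_id s).const_sub 1
    have h3 : HasDerivAt G (-(((1 - s)⁻¹) ^ 2 * expNegInvGlue (1 - s) * -1)) s :=
      (h1.comp s h2).neg
    simpa using h3
  have hG' : ContDiff ℝ ∞ (deriv G) := ((contDiff_infty_iff_deriv.1 hGs).2)
  have hder (s : ℝ) : deriv G s = ((1 - s)⁻¹) ^ 2 * expNegInvGlue (1 - s) := (hGd s).deriv
  set N : EuclideanSpace ℝ (Fin n) → ℝ := fun y => ‖y‖ ^ 2 * (ε ^ 2)⁻¹ with hN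
  have hNs : ContDiff ℝ ∞ N := (contDiff_norm_sq ℝ).mul contDiff_const
  have hN1 {y : EuclideanSpace ℝ (Fin n)} (hy : ¬ y ∈ Metric.closedBall 0 ε) : 1 - N y ≤ 0 := by
    rw [mem_closedBall_zero_iff, not_le] at hy
    have : 1 ≤ ‖y‖ ^ 2 * (ε ^ 2)⁻¹ := by
      rw [← div_eq_mul_inv, one_le_div (by positivity)]
      gcongr
    simpa [hN] using this
  have hsupp {H : ℝ → ℝ} (hH : ∀ s, 1 - s ≤ 0 → H s = 0) :
      tsupport (fun y => H (N y)) ⊆ Metric.closedBall 0 ε :=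
    closure_minimal (fun y hy => by_contra fun h => hy (hH _ (hN1 h))) Metric.isClosed_closedBall
  set φ₀ : EuclideanSpace ℝ (Fin n) → ℝ := fun y => 2 * (ε ^ 2)⁻¹ * deriv G (N y) with hφ₀
  have hφ₀s : ContDiff ℝ ∞ φ₀ := contDiff_const.mul (hG'.comp hNs)
  have hφ₀t : tsupport φ₀ ⊆ Metric.closedBall 0 ε :=
    hsupp (H := fun s => 2 * (ε ^ 2)⁻¹ * deriv G s) fun s hs => by
      simp [hder, expNegInvGlue.zero_of_nonpos hs]
  have hc : 0 < ∫ y, φ₀ y := by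
    refine hφ₀s.continuous.integral_pos_of_hasCompactSupport_nonneg_nonzero
      ((isCompact_closedBall 0 ε).of_isClosed_subset (isClosed_tsupport _) hφ₀t)
      (fun y => ?_) (x := 0) ?_
    · simp only [hφ₀, hder]
      have := expNegInvGlue.nonneg (1 - N y)
      simp only [Pi.zero_apply]
      positivity
    · simp only [hφ₀, hder, hN]
      have := expNegInvGlue.pos_of_pos (x := 1) one_pos
      simp [hε.ne', this.ne']
  refine ⟨fun y => (∫ y, φ₀ y)⁻¹ * φ₀ y, fun y => (∫ y, φ₀ y)⁻¹ * G (N y),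
    contDiff_const.mul hφ₀s, contDiff_const.mul (hGs.comp hNs),
    tsupport_mul_subset_right.trans hφ₀t,
    tsupport_mul_subset_right.trans (hsupp fun s hs => ?_), fun i y => ?_, ?_⟩
  · simp [hG, expNegInvGlue.zero_of_nonpos hs]
  · have hd : Differentiable ℝ (fun y => G (N y)) := (hGs.comp hNs).differentiable (by simp)
    rw [pd_const_mul hd]
    have h1 : HasFDerivAt N ((ε ^ 2)⁻¹ • (2 • innerSL ℝ y)) y :=
      (hasStrictFDerivAt_norm_sq y).hasFDerivAt.mul_const _
    have h2 := (hGs.differentiable (by simp) (N y)).hasDerivAt.comp_hasFDerivAt y h1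
    have h3 : pd i (fun y => G (N y)) y = φ₀ y * y i := by
      rw [pd, show (fun y => G (N y)) = G ∘ N from rfl, h2.fderiv]
      simp [hφ₀, EuclideanSpace.inner_single_right]
      ring
    simp only [h3]
    ring
  · rw [integral_const_mul, inv_mul_cancel₀ hc.ne']

theorem pd_comp_sub_smul {g : EuclideanSpace ℝ (Fin n) → ℝ} (hg : ContDiff ℝ 1 g)
    (x : EuclideanSpace ℝ (Fin n)) (s : ℝ) (i : Fin n) (y : EuclideanSpace ℝ (Fin n)) :
    pd i (fun y => g (x - s • y)) y = -s * pd i g (x - s • y) := by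
  have h2 : HasFDerivAt (fun y : EuclideanSpace ℝ (Fin n) => x - s • y)
      (-(s • ContinuousLinearMap.id ℝ (EuclideanSpace ℝ (Fin n)))) y :=
    ((hasFDerivAt_id y).const_smul s).const_sub x
  have h3 := (hg.differentiable one_ne_zero (x - s • y)).hasFDerivAt.comp y h2
  rw [pd, show (fun y => g (x - s • y)) = g ∘ fun y => x - s • y from rfl, h3.fderiv]
  simp [pd]

/-- For a radial weight the swept field is curl-free: `y ↦ φ(y) y` is a gradient, so the
derivative can be moved between the two factors. -/
theorem pd_sweep_comm {φ Φ g : EuclideanSpace ℝ (Fin n) → ℝ} {ε : ℝ} (hφ : ContDiff ℝ ∞ φ)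
    (hΦ : ContDiff ℝ ∞ Φ) (hφs : tsupport φ ⊆ Metric.closedBall 0 ε)
    (hΦs : tsupport Φ ⊆ Metric.closedBall 0 ε) (hpd : ∀ i y, pd i Φ y = φ y * y i)
    (hg : ContDiff ℝ 1 g) (hgc : HasCompactSupport g) (i j : Fin n)
    (x : EuclideanSpace ℝ (Fin n)) :
    pd j (sweep volume φ id g i) x = pd i (sweep volume φ id g j) x := by
  have hw : Integrable φ := hφ.continuous.integrable_of_hasCompactSupport
    ((isCompact_closedBall 0 ε).of_isClosed_subset (isClosed_tsupport _) hφs)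
  have hΦc : HasCompactSupport Φ :=
    (isCompact_closedBall 0 ε).of_isClosed_subset (isClosed_tsupport _) hΦs
  have hR : ∀ y, φ y ≠ 0 → ‖id y‖ ≤ ε := fun y hy =>
    mem_closedBall_zero_iff.1 (hφs (subset_tsupport _ hy))
  obtain ⟨hI₁, h₁⟩ := pd_sweep hw measurable_id hR hg hgc i j x
  obtain ⟨hI₂, h₂⟩ := pd_sweep hw measurable_id hR hg hgc j i x
  rw [h₁, h₂, integral_prod_symm _ hI₁, integral_prod_symm _ hI₂]
  -- For fixed `s ≠ 0`, `∂ⱼg(x - s y)` is `-1/s` times the `y`-derivative of `g(x - s y)`.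
  have hae : ∀ᵐ s : ℝ ∂(volume.restrict (Icc 0 1)), s ≠ 0 :=
    ae_restrict_of_ae (Measure.ae_ne volume 0)
  refine integral_congr_ae ?_
  filter_upwards [hae] with s hs
  simp only [id, ← hpd]
  have hgx : ContDiff ℝ 1 (fun y => g (x - s • y)) :=
    hg.comp (contDiff_const.sub (contDiff_id.const_smul s))
  have key := integral_pd_mul_pd_comm hgx (contDiff_infty.1 hΦ 2) hΦc j i
  simp only [pd_comp_sub_smul hg, mul_assoc, integral_const_mul] at key
  simpa only [mul_comm] using mul_left_cancel₀ (neg_ne_zero.2 hs) key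

/-- A `C¹` density of zero mean with compact support in a connected open set `O` is the divergence
of a `C¹` field with compact support in `O` whose curl is smooth: the field is the sum of a
curl-free one, carrying the difference between `f` and a mollification of `f`, and of a smooth one,
carrying the mollification. -/
theorem exists_curlFree_add_smooth {O : Set (EuclideanSpace ℝ (Fin n))} (hO : IsOpen O)
    (hOc : IsConnected O) {f : EuclideanSpace ℝ (Fin n) → ℝ} (hf : ContDiff ℝ 1 f)
    (hfc : HasCompactSupport f) (hfO : tsupport f ⊆ O) (hf0 : ∫ x, f x = 0) :
    ∃ A V : Fin n → EuclideanSpace ℝ (Fin n) → ℝ,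
      (∀ i, ContDiff ℝ 1 (A i)) ∧ (∀ i, HasCompactSupport (A i)) ∧ (∀ i, tsupport (A i) ⊆ O) ∧
      (∀ i, ContDiff ℝ ∞ (V i)) ∧ (∀ i, HasCompactSupport (V i)) ∧ (∀ i, tsupport (V i) ⊆ O) ∧
      (∀ i j x, pd j (A i) x = pd i (A j) x) ∧
      ∀ x, ∑ i, (pd i (A i) x + pd i (V i) x) = f x := by
  obtain ⟨b, hb⟩ := hOc.nonempty
  obtain ⟨ε₁, hε₁, H⟩ := exists_isSmoothDivergence_mollify hO hOc.isPreconnected hfc hfO hb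
  obtain ⟨ε₂, hε₂, hthick⟩ := hfc.isCompact.exists_cthickening_subset_open hO hfO
  obtain ⟨φ, Φ, hφ, hΦ, hφs, hΦs, hpd, hφ1⟩ :=
    exists_radial_mollifier (n := n) (lt_min hε₁ hε₂)
  have hw : Integrable φ := hφ.continuous.integrable_of_hasCompactSupport
    ((isCompact_closedBall 0 _).of_isClosed_subset (isClosed_tsupport _) hφs)
  have hfi : Integrable f := hf.continuous.integrable_of_hasCompactSupport hfc
  have hR : ∀ y, φ y ≠ 0 → ‖id y‖ ≤ min ε₁ ε₂ := fun y hy =>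
    mem_closedBall_zero_iff.1 (hφs (subset_tsupport _ hy))
  have hAs (i : Fin n) : tsupport (sweep volume φ id f i) ⊆ Metric.cthickening ε₂ (tsupport f) := by
    refine tsupport_sweep_subset Metric.isClosed_cthickening (fun y hy s hs z hz => ?_) i
    refine Metric.mem_cthickening_of_dist_le _ z _ _ hz ?_
    rw [dist_eq_norm, add_sub_cancel_left, norm_smul, Real.norm_of_nonneg hs.1]
    exact (mul_le_of_le_one_left (norm_nonneg _) hs.2).trans ((hR y hy).trans (min_le_right _ _))
  obtain ⟨V, hV, hVc, hVs, hVd⟩ := H φ hφ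
    (hφs.trans (Metric.closedBall_subset_closedBall (min_le_left _ _))) f hfi
    (fun y hy => subset_tsupport _ hy)
  refine ⟨sweep volume φ id f, fun i x => -1 * V i x, fun i => ?_, fun i => ?_,
    fun i => (hAs i).trans hthick, fun i => contDiff_const.mul (hV i), fun i => (hVc i).mul_left,
    fun i => tsupport_mul_subset_right.trans (hVs i),
    pd_sweep_comm hφ hΦ hφs hΦs hpd hf hfc, fun x => ?_⟩
  · simpa using contDiff_sweep hw measurable_id hR 0 (by simpa using hf) hfc i
  · exact hfc.isCompact.cthickening.of_isClosed_subset (isClosed_tsupport _) (hAs i)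
  · have hφf : Integrable (fun y => φ y * f (x - y)) := by
      have := hf.continuous
      have := hφ.continuous
      exact Continuous.integrable_of_hasCompactSupport (by fun_prop) (HasCompactSupport.mul_right
        ((isCompact_closedBall 0 _).of_isClosed_subset (isClosed_tsupport _) hφs))
    have hfφ : Integrable (fun y => f y * φ (x - y)) := by
      have := hf.continuous
      have := hφ.continuous
      exact Continuous.integrable_of_hasCompactSupport (by fun_prop) hfc.mul_right
    have e : ∫ y, φ y * f (x - y) = ∫ y, f y * φ (x - y) := by
      rw [← integral_sub_left_eq_self _ volume x]
      simp only [sub_sub_cancel, mul_comm]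
    simp only [pd_const_mul ((hV _).differentiable (by simp))]
    rw [Finset.sum_add_distrib, sum_pd_sweep hw measurable_id hR hf hfc, ← Finset.mul_sum, ← hVd]
    simp only [id, mul_sub]
    rw [integral_sub (hw.mul_const _) hφf, integral_sub (hfi.mul_const _) hfφ,
      integral_mul_const, integral_mul_const, hφ1, hf0, e]
    ring

end Splitting

/-! ### The largest eigenvalue -/

section LambdaMax

variable {n : ℕ}

theorem abs_le_of_hasEigenvalue {S : Matrix (Fin n) (Fin n) ℝ} {μ : ℝ}
    (h : Module.End.HasEigenvalue (Matrix.toLin' S) μ) : |μ| ≤ ∑ i, ∑ j, |S i j| := by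
  obtain ⟨v, hv⟩ := h.exists_hasEigenvector
  have hv' : S.mulVec v = μ • v := by simpa using hv.apply_eq_smul
  have hpos : 0 < ‖v‖ := norm_pos_iff.2 hv.2
  refine le_of_mul_le_mul_right ?_ hpos
  rw [← Real.norm_eq_abs μ, ← norm_smul, ← hv', pi_norm_le_iff_of_nonneg (by positivity)]
  intro i
  rw [Matrix.mulVec, dotProduct, Real.norm_eq_abs]
  calc |∑ j, S i j * v j| ≤ ∑ j, |S i j| * ‖v‖ :=
        (Finset.abs_sum_le_sum_abs _ _).trans (Finset.sum_le_sum fun j _ => by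
          rw [abs_mul]
          exact mul_le_mul_of_nonneg_left (norm_le_pi_norm v j) (abs_nonneg _))
    _ = (∑ j, |S i j|) * ‖v‖ := by rw [Finset.sum_mul]
    _ ≤ (∑ i, ∑ j, |S i j|) * ‖v‖ := by
        refine mul_le_mul_of_nonneg_right ?_ (norm_nonneg _)
        exact Finset.single_le_sum (f := fun i => ∑ j, |S i j|)
          (fun i _ => Finset.sum_nonneg fun j _ => abs_nonneg _) (Finset.mem_univ i)

theorem abs_lambdaMax_le (S : Matrix (Fin n) (Fin n) ℝ) :
    |lambdaMax S| ≤ ∑ i, ∑ j, |S i j| := by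
  have hB : 0 ≤ ∑ i, ∑ j, |S i j| := by positivity
  have hle : ∀ μ ∈ {μ : ℝ | Module.End.HasEigenvalue (Matrix.toLin' S) μ},
      |μ| ≤ ∑ i, ∑ j, |S i j| := fun μ hμ => abs_le_of_hasEigenvalue hμ
  rw [lambdaMax]
  rcases eq_empty_or_nonempty {μ : ℝ | Module.End.HasEigenvalue (Matrix.toLin' S) μ} with h | h
  · rw [h, Real.sSup_empty, abs_zero]
    exact hB
  · obtain ⟨μ, hμ⟩ := h
    refine abs_le.2 ⟨(neg_le_of_abs_le (hle μ hμ)).trans (le_csSup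
      ⟨_, fun ν hν => le_of_abs_le (hle ν hν)⟩ hμ), csSup_le ⟨μ, hμ⟩
      fun ν hν => le_of_abs_le (hle ν hν)⟩

/-- The variational characterization of the largest eigenvalue: it dominates the quadratic form
and is attained by it. -/
theorem lambdaMax_variational [NeZero n] {S : Matrix (Fin n) (Fin n) ℝ} (hS : S.IsSymm) :
    (∀ v : Fin n → ℝ, v ⬝ᵥ S.mulVec v ≤ lambdaMax S * (v ⬝ᵥ v)) ∧
    ∃ v : Fin n → ℝ, 0 < v ⬝ᵥ v ∧ v ⬝ᵥ S.mulVec v = lambdaMax S * (v ⬝ᵥ v) := by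
  have hsymm : (Matrix.toEuclideanLin S).IsSymmetric :=
    Matrix.isSymmetric_toEuclideanLin_iff.2 (by simpa [Matrix.IsHermitian] using hS.eq)
  have hdot (v : Fin n → ℝ) : v ⬝ᵥ v = ‖WithLp.toLp 2 v‖ ^ 2 := by
    rw [EuclideanSpace.norm_sq_eq, dotProduct]
    simp [pow_two]
  have hpos {v : Fin n → ℝ} (hv : v ≠ 0) : 0 < v ⬝ᵥ v := by
    rw [hdot]
    exact pow_pos (norm_pos_iff.2 (by simpa using hv)) 2
  have hquad (v : Fin n → ℝ) : v ⬝ᵥ S.mulVec v =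
      inner ℝ (Matrix.toEuclideanLin S (WithLp.toLp 2 v)) (WithLp.toLp 2 v) := by
    simp [Matrix.toLpLin_apply, EuclideanSpace.inner_toLp_toLp]
  have heig {μ : ℝ} : Module.End.HasEigenvalue (Matrix.toEuclideanLin S) μ ↔
      Module.End.HasEigenvalue (Matrix.toLin' S) μ := by
    constructor
    · intro h
      obtain ⟨v, hv⟩ := h.exists_hasEigenvector
      refine Module.End.hasEigenvalue_of_hasEigenvector (x := v.ofLp)
        ⟨Module.End.mem_eigenspace_iff.2 ?_, fun h0 => hv.2 ?_⟩
      · simpa [Matrix.toLpLin_apply] using congrArg WithLp.ofLp hv.apply_eq_smul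
      · ext i
        simpa using congrFun h0 i
    · intro h
      obtain ⟨v, hv⟩ := h.exists_hasEigenvector
      refine Module.End.hasEigenvalue_of_hasEigenvector (x := WithLp.toLp 2 v)
        ⟨Module.End.mem_eigenspace_iff.2 ?_, fun h0 => hv.2 ?_⟩
      · have := hv.apply_eq_smul
        rw [Matrix.toLin'_apply] at this
        simp [Matrix.toLpLin_apply, this]
      · simpa using h0
  have hμ₀ := hsymm.hasEigenvalue_iSup_of_finiteDimensional
  set R : {x : EuclideanSpace ℝ (Fin n) // x ≠ 0} → ℝ := fun x =>
    RCLike.re (inner ℝ (Matrix.toEuclideanLin S x) (x : EuclideanSpace ℝ (Fin n))) /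
      ‖(x : EuclideanSpace ℝ (Fin n))‖ ^ 2 with hR
  have hbdd : BddAbove (range R) := by
    refine ⟨‖LinearMap.toContinuousLinearMap (Matrix.toEuclideanLin S)‖, ?_⟩
    rintro _ ⟨⟨x, hx⟩, rfl⟩
    have hx' : 0 < ‖x‖ := norm_pos_iff.2 hx
    simp only [hR, RCLike.re_to_real]
    rw [div_le_iff₀ (by positivity), pow_two, ← mul_assoc]
    refine (real_inner_le_norm _ _).trans ?_
    gcongr
    exact (LinearMap.toContinuousLinearMap (Matrix.toEuclideanLin S)).le_opNorm x
  have hray (v : Fin n → ℝ) : v ⬝ᵥ S.mulVec v ≤ (⨆ x, R x) * (v ⬝ᵥ v) := by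
    by_cases hv : WithLp.toLp 2 v = 0
    · have : v = 0 := by simpa using hv
      simp [this]
    · have := le_ciSup hbdd ⟨_, hv⟩
      rw [hR] at this
      simp only [RCLike.re_to_real] at this
      rw [div_le_iff₀ (by have := norm_pos_iff.2 hv; positivity)] at this
      rw [hquad, hdot]
      exact this
  have hmax : lambdaMax S = ⨆ x, R x := by
    refine IsGreatest.csSup_eq ⟨heig.1 (by simpa using hμ₀), fun μ hμ => ?_⟩
    obtain ⟨v, hv⟩ := Module.End.HasEigenvalue.exists_hasEigenvector hμ
    have h1 : S.mulVec v = μ • v := by simpa using hv.apply_eq_smul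
    have h2 := hray v
    rw [h1, dotProduct_smul, smul_eq_mul] at h2
    exact le_of_mul_le_mul_right h2 (hpos hv.2)
  refine ⟨fun v => hmax ▸ hray v, ?_⟩
  obtain ⟨v, hv⟩ := (heig.1 (show Module.End.HasEigenvalue _ (⨆ x, R x) by
    simpa using hμ₀)).exists_hasEigenvector
  have h1 : S.mulVec v = (⨆ x, R x) • v := by simpa using hv.apply_eq_smul
  refine ⟨v, hpos hv.2, ?_⟩
  rw [h1, dotProduct_smul, smul_eq_mul, hmax]

theorem lowerSemicontinuous_lambdaMax [NeZero n] {X : Type*} [TopologicalSpace X]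
    {S : X → Matrix (Fin n) (Fin n) ℝ} (hS : Continuous S) (hsymm : ∀ x, (S x).IsSymm) :
    LowerSemicontinuous fun x => lambdaMax (S x) := by
  intro x L hL
  obtain ⟨v, hv, hSv⟩ := (lambdaMax_variational (hsymm x)).2
  have hcont : Continuous fun y => v ⬝ᵥ (S y).mulVec v :=
    continuous_const.dotProduct (hS.matrix_mulVec continuous_const)
  have hlt : L * (v ⬝ᵥ v) < v ⬝ᵥ (S x).mulVec v := by
    rw [hSv]
    exact mul_lt_mul_of_pos_right hL hv
  filter_upwards [hcont.continuousAt.eventually_const_lt hlt] with y hy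
  exact lt_of_mul_lt_mul_right (hy.trans_le ((lambdaMax_variational (hsymm y)).1 v)) hv.le

/-- A lower semicontinuous function is bounded on an open set by its essential supremum there. -/
theorem le_eLpNorm_top_of_lowerSemicontinuous {O : Set (EuclideanSpace ℝ (Fin n))} (hO : IsOpen O)
    {e : EuclideanSpace ℝ (Fin n) → ℝ} (he : LowerSemicontinuous e)
    (hfin : eLpNorm e ⊤ (volume.restrict O) ≠ ⊤) {x : EuclideanSpace ℝ (Fin n)} (hx : x ∈ O) :
    e x ≤ (eLpNorm e ⊤ (volume.restrict O)).toReal := by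
  by_contra! hlt
  have hae : ∀ᵐ y ∂(volume : Measure (EuclideanSpace ℝ (Fin n))), y ∈ O →
      ‖e y‖ₑ ≤ eLpNorm e ⊤ (volume.restrict O) := by
    rw [← ae_restrict_iff' hO.measurableSet, eLpNorm_exponent_top]
    exact ae_le_eLpNormEssSup
  obtain ⟨N, hN, hNo, hxN⟩ := mem_nhds_iff.1 (he x _ hlt)
  obtain ⟨y, hy, hyp⟩ := (Measure.dense_of_ae hae).exists_mem_open (hNo.inter hO) ⟨x, hxN, hx⟩
  have h1 := ENNReal.toReal_mono hfin (hy hyp.2)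
  rw [toReal_enorm] at h1
  exact absurd (hN hyp.1) (not_lt.2 ((le_abs_self _).trans h1))

end LambdaMax

/-! ### The stress and the momentum of a vector field -/

section Stress

variable {n : ℕ}

/-- Minus the trace-free symmetric gradient of the field with components `W i`, with the
normalization `n / (2 (n - 1))` that makes `div div` of it equal to `-Δ (div W)`. -/
noncomputable def stress (W : Fin n → EuclideanSpace ℝ (Fin n) → ℝ)
    (x : EuclideanSpace ℝ (Fin n)) : Matrix (Fin n) (Fin n) ℝ :=
  Matrix.of fun i j => -((n : ℝ) / (2 * (n - 1))) *
    (pd j (W i) x + pd i (W j) x - if i = j then 2 / (n : ℝ) * ∑ k, pd k (W k) x else 0)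

/-- The curl `∂ⱼVᵢ - ∂ᵢVⱼ` of the field with components `V i`. -/
noncomputable def curl (V : Fin n → EuclideanSpace ℝ (Fin n) → ℝ) (i j : Fin n)
    (x : EuclideanSpace ℝ (Fin n)) : ℝ :=
  pd j (V i) x - pd i (V j) x

/-- The divergence of the antisymmetric matrix field `curl V`, with the normalization of
`stress`. -/
noncomputable def curlFlux (V : Fin n → EuclideanSpace ℝ (Fin n) → ℝ)
    (x : EuclideanSpace ℝ (Fin n)) : EuclideanSpace ℝ (Fin n) :=
  WithLp.toLp 2 fun i => (n : ℝ) / (2 * (n - 1)) * ∑ j, pd j (curl V i j) x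

variable {W V : Fin n → EuclideanSpace ℝ (Fin n) → ℝ}

theorem continuous_stress (hW : ∀ i, ContDiff ℝ 1 (W i)) : Continuous (stress W) := by
  have h := fun i j => (hW i).continuous_pd j
  refine continuous_matrix fun i j => ?_
  simp only [stress, Matrix.of_apply]
  split_ifs <;> fun_prop

theorem isSymm_stress (x : EuclideanSpace ℝ (Fin n)) : (stress W x).IsSymm := by
  refine Matrix.IsSymm.ext fun i j => ?_
  simp only [stress, Matrix.of_apply, eq_comm (a := j) (b := i)]
  ring

theorem trace_stress (hn : 2 ≤ n) (x : EuclideanSpace ℝ (Fin n)) : (stress W x).trace = 0 := by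
  have hn0 : (n : ℝ) ≠ 0 := by positivity
  simp only [Matrix.trace, Matrix.diag_apply, stress, Matrix.of_apply, if_true, ← Finset.mul_sum,
    Finset.sum_sub_distrib, Finset.sum_add_distrib, Finset.sum_const, Finset.card_univ,
    Fintype.card_fin, nsmul_eq_mul]
  field_simp
  ring

theorem tsupport_stress_subset {K : Set (EuclideanSpace ℝ (Fin n))} (hK : IsClosed K)
    (hW : ∀ i, tsupport (W i) ⊆ K) : tsupport (stress W) ⊆ K := by
  refine closure_minimal (fun x hx => by_contra fun hxK => hx ?_) hK
  have h0 (i j : Fin n) : pd j (W i) x = 0 :=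
    image_eq_zero_of_notMem_tsupport fun h => hxK (hW i (tsupport_pd_subset j _ h))
  ext i j
  simp [stress, h0]

theorem contDiff_curl (hV : ∀ i, ContDiff ℝ ∞ (V i)) (i j : Fin n) : ContDiff ℝ ∞ (curl V i j) :=
  ((hV i).pd_infty j).sub ((hV j).pd_infty i)

theorem contDiff_curlFlux (hV : ∀ i, ContDiff ℝ ∞ (V i)) : ContDiff ℝ ∞ (curlFlux V) :=
  contDiff_euclidean.2 fun i =>
    contDiff_const.mul (ContDiff.sum fun j _ => (contDiff_curl hV i j).pd_infty j)

theorem tsupport_curlFlux_subset {K : Set (EuclideanSpace ℝ (Fin n))} (hK : IsClosed K)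
    (hV : ∀ i, tsupport (V i) ⊆ K) : tsupport (curlFlux V) ⊆ K := by
  refine closure_minimal (fun x hx => by_contra fun hxK => hx ?_) hK
  have hc (i j : Fin n) : tsupport (curl V i j) ⊆ K :=
    (tsupport_sub _ _).trans (union_subset ((tsupport_pd_subset j _).trans (hV i))
      ((tsupport_pd_subset i _).trans (hV j)))
  have h0 (i j : Fin n) : pd j (curl V i j) x = 0 :=
    image_eq_zero_of_notMem_tsupport fun h => hxK (hc i j (tsupport_pd_subset j _ h))
  ext i
  simp [curlFlux, h0]

theorem fderiv_apply_coord {X : Type*} [NormedAddCommGroup X] [NormedSpace ℝ X]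
    {v : X → EuclideanSpace ℝ (Fin n)} {x : X} (hv : DifferentiableAt ℝ v x) (e : X) (i : Fin n) :
    (fderiv ℝ v x e) i = fderiv ℝ (fun y => v y i) x e := by
  have h : HasFDerivAt (fun y => v y i) ((EuclideanSpace.proj i :
      EuclideanSpace ℝ (Fin n) →L[ℝ] ℝ).comp (fderiv ℝ v x)) x :=
    (EuclideanSpace.proj i : EuclideanSpace ℝ (Fin n) →L[ℝ] ℝ).hasFDerivAt.comp x hv.hasFDerivAt
  rw [h.fderiv]
  rfl

theorem divergence_smul_curlFlux (hV : ∀ i, ContDiff ℝ ∞ (V i)) (t : ℝ)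
    (x : EuclideanSpace ℝ (Fin n)) : divergence (fun y => t • curlFlux V y) x = 0 := by
  have hd : Differentiable ℝ (fun y => t • curlFlux V y) :=
    ((contDiff_curlFlux hV).const_smul t).differentiable (by simp)
  have hpd (i j : Fin n) : Differentiable ℝ (pd j (curl V i j)) :=
    ((contDiff_curl hV i j).pd_infty j).differentiable (by simp)
  have hsum (i : Fin n) : Differentiable ℝ (fun y => ∑ j, pd j (curl V i j) y) :=
    Differentiable.fun_sum fun j _ => hpd i j
  have e (i : Fin n) : (fderiv ℝ (fun y => t • curlFlux V y) x (EuclideanSpace.single i 1)) i =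
      t * ((n : ℝ) / (2 * (n - 1)) * ∑ j, pd i (pd j (curl V i j)) x) := by
    rw [fderiv_apply_coord (hd x)]
    change pd i (fun y => t * ((n : ℝ) / (2 * (n - 1)) * ∑ j, pd j (curl V i j) y)) x = _
    rw [pd_const_mul ((hsum i).const_mul _)]
    simp only [pd_const_mul (hsum i), pd_sum Finset.univ (hpd i)]
  have anti (i j : Fin n) : pd j (pd i (curl V j i)) x = -pd i (pd j (curl V i j)) x := by
    have h1 : curl V j i = fun y => -1 * curl V i j y := by
      funext y
      simp [curl]
    rw [h1, pd_const_mul ((contDiff_curl hV i j).differentiable (by simp)),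
      pd_const_mul (((contDiff_curl hV i j).pd_infty i).differentiable (by simp)),
      pd_comm (contDiff_infty.1 (contDiff_curl hV i j) 2)]
    ring
  have hz : ∑ i, ∑ j, pd i (pd j (curl V i j)) x = 0 := by
    have h1 : ∑ i, ∑ j, pd i (pd j (curl V i j)) x = -∑ i, ∑ j, pd i (pd j (curl V i j)) x := by
      refine Finset.sum_comm.trans ?_
      simp only [← Finset.sum_neg_distrib]
      exact Finset.sum_congr rfl fun i _ => Finset.sum_congr rfl fun j _ => anti i j
    linarith
  simp only [divergence, e, ← Finset.mul_sum, hz, mul_zero]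

/-! ### The momentum equation -/

theorem integral_pd_eq_zero {h : EuclideanSpace ℝ (Fin n) → ℝ} (hh : ContDiff ℝ 1 h)
    (hc : HasCompactSupport h) (i : Fin n) : ∫ x, pd i h x = 0 := by
  have := integral_mul_pd (g := fun _ => 1) contDiff_const hh hc i
  simpa [pd] using this

/-- The stationary balance `div (stress W) + ∇ (div W) + curlFlux V = 0` in the sense of
distributions, when `W` and `V` have the same curl. -/
theorem integral_stress_balance (hn : 2 ≤ n) (hW : ∀ i, ContDiff ℝ 1 (W i))
    (hV : ∀ i, ContDiff ℝ ∞ (V i))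
    (hWV : ∀ i j x, pd j (W i) x = pd i (W j) x + curl V i j x)
    {η : Fin n → EuclideanSpace ℝ (Fin n) → ℝ} (hη : ∀ i, ContDiff ℝ ∞ (η i))
    (hηc : ∀ i, HasCompactSupport (η i)) :
    ∫ x, (∑ i, ∑ j, stress W x i j * pd j (η i) x + (∑ k, pd k (W k) x) * ∑ i, pd i (η i) x
      - ∑ i, curlFlux V x i * η i x) = 0 := by
  have hn0 : (n : ℝ) ≠ 0 := by positivity
  have hn1 : (n : ℝ) - 1 ≠ 0 := by
    have : (2 : ℝ) ≤ n := by exact_mod_cast hn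
    linarith
  set c : ℝ := (n : ℝ) / (2 * (n - 1)) with hc
  have hcn : 1 + c * (2 / n) = 2 * c := by
    rw [hc]
    field_simp
    ring
  have hpt (x : EuclideanSpace ℝ (Fin n)) :
      ∑ i, ∑ j, stress W x i j * pd j (η i) x + (∑ k, pd k (W k) x) * ∑ i, pd i (η i) x
        - ∑ i, curlFlux V x i * η i x =
      ∑ i, ∑ j, (-(2 * c) * (pd i (W j) x * pd j (η i) x - pd j (W j) x * pd i (η i) x) -
        c * (curl V i j x * pd j (η i) x + pd j (curl V i j) x * η i x)) := by
    have e1 (i : Fin n) : ∑ j, stress W x i j * pd j (η i) x =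
        ∑ j, (-(2 * c) * (pd i (W j) x * pd j (η i) x) - c * (curl V i j x * pd j (η i) x)) +
          c * (2 / n) * (∑ k, pd k (W k) x) * pd i (η i) x := by
      have : c * (2 / n) * (∑ k, pd k (W k) x) * pd i (η i) x =
          ∑ j, if i = j then c * (2 / n) * (∑ k, pd k (W k) x) * pd j (η i) x else 0 := by
        simp
      rw [this, ← Finset.sum_add_distrib]
      refine Finset.sum_congr rfl fun j _ => ?_
      simp only [stress, Matrix.of_apply, hWV i j, ← hc]
      split_ifs <;> ring
    simp only [e1, Finset.sum_add_distrib, Finset.sum_sub_distrib, ← Finset.mul_sum, mul_sub,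
      mul_add, ← Finset.sum_mul, curlFlux, mul_assoc]
    simp only [← mul_assoc, hcn.symm]
    ring
  simp only [hpt]
  have hη1 (i : Fin n) : ContDiff ℝ 1 (η i) := contDiff_infty.1 (hη i) 1
  have hcurl (i j : Fin n) : ContDiff ℝ 1 (curl V i j) := contDiff_infty.1 (contDiff_curl hV i j) 1
  have i1 (a b i j : Fin n) : Integrable (fun x => pd a (W b) x * pd j (η i) x) :=
    (((hW b).continuous_pd a).mul ((hη1 i).continuous_pd j)).integrable_of_hasCompactSupport
      ((hηc i).pd j).mul_left
  have i2 (i j : Fin n) : Integrable (fun x => curl V i j x * pd j (η i) x) :=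
    ((hcurl i j).continuous.mul ((hη1 i).continuous_pd j)).integrable_of_hasCompactSupport
      ((hηc i).pd j).mul_left
  have i3 (i j : Fin n) : Integrable (fun x => pd j (curl V i j) x * η i x) :=
    (((hcurl i j).continuous_pd j).mul (hη1 i).continuous).integrable_of_hasCompactSupport
      (hηc i).mul_left
  have j1 (i j : Fin n) : Integrable (fun x => -(2 * c) * (pd i (W j) x * pd j (η i) x -
      pd j (W j) x * pd i (η i) x)) := ((i1 i j i j).sub (i1 j j i i)).const_mul _
  have j2 (i j : Fin n) : Integrable (fun x => c * (curl V i j x * pd j (η i) x +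
      pd j (curl V i j) x * η i x)) := ((i2 i j).add (i3 i j)).const_mul _
  have j3 (i j : Fin n) : Integrable (fun x => -(2 * c) * (pd i (W j) x * pd j (η i) x -
      pd j (W j) x * pd i (η i) x) - c * (curl V i j x * pd j (η i) x +
      pd j (curl V i j) x * η i x)) := (j1 i j).sub (j2 i j)
  rw [integral_finsetSum _ fun i _ => integrable_finsetSum _ fun j _ => j3 i j]
  refine Finset.sum_eq_zero fun i _ => ?_
  rw [integral_finsetSum _ fun j _ => j3 i j]
  refine Finset.sum_eq_zero fun j _ => ?_
  rw [integral_sub (j1 i j) (j2 i j), integral_const_mul, integral_const_mul,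
    integral_sub (i1 i j i j) (i1 j j i i), integral_add (i2 i j) (i3 i j),
    integral_pd_mul_pd_comm (hW j) (contDiff_infty.1 (hη i) 2) (hηc i) i j,
    integral_mul_pd (hcurl i j) (hη1 i) (hηc i) j]
  ring

end Stress

section WeakForm

variable {n : ℕ} {W V : Fin n → EuclideanSpace ℝ (Fin n) → ℝ}

/-- Integration by parts in time for a field linear in `t`. -/
theorem integral_smul_time_derivative {w : EuclideanSpace ℝ (Fin n) → ℝ} (hw : ContDiff ℝ 1 w)
    {ψ : EuclideanSpace ℝ (Fin n) × ℝ → ℝ} (hψ : ContDiff ℝ 1 ψ) (hψc : HasCompactSupport ψ) :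
    Integrable (fun z => z.2 * w z.1 * fderiv ℝ ψ z (0, 1) + w z.1 * ψ z) ∧
    ∫ z, (z.2 * w z.1 * fderiv ℝ ψ z (0, 1) + w z.1 * ψ z) = 0 := by
  set G : EuclideanSpace ℝ (Fin n) × ℝ → ℝ := fun z => z.2 * w z.1 with hG
  have hw1 : ContDiff ℝ 1 (fun z : EuclideanSpace ℝ (Fin n) × ℝ => w z.1) := hw.comp contDiff_fst
  have hGs : ContDiff ℝ 1 G := contDiff_snd.mul hw1
  have hGd (z : EuclideanSpace ℝ (Fin n) × ℝ) : fderiv ℝ G z (0, 1) = w z.1 := by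
    have h1 : HasFDerivAt (fun z : EuclideanSpace ℝ (Fin n) × ℝ => w z.1)
        ((fderiv ℝ w z.1).comp (ContinuousLinearMap.fst ℝ _ _)) z :=
      (hw.differentiable one_ne_zero z.1).hasFDerivAt.comp z hasFDerivAt_fst
    have h2 : HasFDerivAt G _ z := (hasFDerivAt_snd (𝕜 := ℝ)).mul h1
    rw [h2.fderiv]
    simp
  have hψ' : Continuous (fun z => fderiv ℝ ψ z (0, 1)) :=
    (hψ.continuous_fderiv one_ne_zero).clm_apply continuous_const
  have i1 : Integrable (fun z => G z * fderiv ℝ ψ z (0, 1)) :=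
    (hGs.continuous.mul hψ').integrable_of_hasCompactSupport (hψc.fderiv_apply ℝ _).mul_left
  have i2 : Integrable (fun z => w z.1 * ψ z) :=
    (hw1.continuous.mul hψ.continuous).integrable_of_hasCompactSupport hψc.mul_left
  have i3 : Integrable (fun z => G z * ψ z) :=
    (hGs.continuous.mul hψ.continuous).integrable_of_hasCompactSupport hψc.mul_left
  refine ⟨i1.add i2, ?_⟩
  have : (volume : Measure (EuclideanSpace ℝ (Fin n) × ℝ)).IsAddHaarMeasure :=
    inferInstanceAs ((volume : Measure (EuclideanSpace ℝ (Fin n))).prod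
      (volume : Measure ℝ)).IsAddHaarMeasure
  rw [integral_add i1 i2, integral_mul_fderiv_eq_neg_fderiv_mul_of_integrable
    (by simpa only [hGd] using i2) i1 i3 (fun z _ => hGs.differentiable one_ne_zero z)
    (fun z _ => hψ.differentiable one_ne_zero z)]
  simp only [hGd, neg_add_cancel]

/-- The stationary balance between `W` and `V` gives the momentum equation for the momentum
`t • curlFlux V`; functions of time alone may be added to the pressure. -/
theorem weakMomentumEquation_stress (hn : 2 ≤ n) (hW : ∀ i, ContDiff ℝ 1 (W i))
    (hV : ∀ i, ContDiff ℝ ∞ (V i))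
    (hWV : ∀ i j x, pd j (W i) x = pd i (W j) x + curl V i j x)
    {J : Set ℝ} (hJ : IsOpen J) {κ : ℝ → ℝ} (hκ : ContinuousOn κ J) :
    WeakMomentumEquation (fun x t => t • curlFlux V x) (stress W)
      (fun x t => ∑ k, pd k (W k) x + κ t) J := by
  intro φ hφ hφc hφJ
  have hφd : Differentiable ℝ φ := hφ.differentiable (by simp)
  have hφi (i : Fin n) : ContDiff ℝ ∞ (fun z => φ z i) := contDiff_euclidean.1 hφ i
  have hφic (i : Fin n) : HasCompactSupport (fun z => φ z i) :=
    hφc.comp_left (g := fun v : EuclideanSpace ℝ (Fin n) => v i) rfl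
  set η : ℝ → Fin n → EuclideanSpace ℝ (Fin n) → ℝ := fun t i x => φ (x, t) i with hη
  have hηs (t : ℝ) (i : Fin n) : ContDiff ℝ ∞ (η t i) :=
    (hφi i).comp (contDiff_id.prodMk contDiff_const)
  have hηc (t : ℝ) (i : Fin n) : HasCompactSupport (η t i) := by
    refine HasCompactSupport.of_support_subset_isCompact
      ((hφic i).isCompact.image continuous_fst) fun x hx => ?_
    exact ⟨(x, t), subset_tsupport _ hx, rfl⟩
  have hηd (z : EuclideanSpace ℝ (Fin n) × ℝ) (i j : Fin n) :
      (fderiv ℝ φ z (EuclideanSpace.single j 1, 0)) i = pd j (η z.2 i) z.1 := by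
    rw [fderiv_apply_coord (hφd z)]
    have h1 : HasFDerivAt (fun x : EuclideanSpace ℝ (Fin n) => (x, z.2))
        (ContinuousLinearMap.inl ℝ (EuclideanSpace ℝ (Fin n)) ℝ) z.1 := hasFDerivAt_prodMk_left _ _
    have h2 : HasFDerivAt (η z.2 i) ((fderiv ℝ (fun z => φ z i) z).comp
        (ContinuousLinearMap.inl ℝ (EuclideanSpace ℝ (Fin n)) ℝ)) z.1 :=
      HasFDerivAt.comp (g := fun z => φ z i) z.1
        (((hφi i).differentiable (by simp) z).hasFDerivAt) h1
    rw [pd, h2.fderiv]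
    simp
  have hηcont (i j : Fin n) :
      Continuous (fun z : EuclideanSpace ℝ (Fin n) × ℝ => pd j (η z.2 i) z.1) := by
    have h1 : Continuous fun z => fderiv ℝ φ z (EuclideanSpace.single j 1, 0) :=
      (hφ.continuous_fderiv (by simp)).clm_apply continuous_const
    have h2 : Continuous fun z => (fderiv ℝ φ z (EuclideanSpace.single j 1, 0)) i :=
      (EuclideanSpace.proj i : EuclideanSpace ℝ (Fin n) →L[ℝ] ℝ).continuous.comp h1
    simpa only [hηd] using h2
  have hηzero (i j : Fin n) {z : EuclideanSpace ℝ (Fin n) × ℝ} (hz : z ∉ tsupport φ) :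
      pd j (η z.2 i) z.1 = 0 := by
    rw [← hηd, image_eq_zero_of_notMem_tsupport fun h => hz (tsupport_fderiv_subset ℝ h)]
    rfl
  have hw : ContDiff ℝ ∞ (curlFlux V) := contDiff_curlFlux hV
  have hwi (i : Fin n) : ContDiff ℝ 1 (fun x => curlFlux V x i) :=
    contDiff_infty.1 (contDiff_euclidean.1 hw i) 1
  have hpdW (k : Fin n) : Continuous (pd k (W k)) := (hW k).continuous_pd k
  -- The time derivative, the stationary balance, and the purely temporal part of the pressure.
  obtain ⟨I₁, hI₁⟩ : ∃ I : EuclideanSpace ℝ (Fin n) × ℝ → ℝ, I = fun z => ∑ i,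
    (z.2 * curlFlux V z.1 i * fderiv ℝ (fun z => φ z i) z (0, 1) + curlFlux V z.1 i * φ z i) :=
    ⟨_, rfl⟩
  obtain ⟨I₂, hI₂⟩ : ∃ I : EuclideanSpace ℝ (Fin n) × ℝ → ℝ, I = fun z =>
    ∑ i, ∑ j, stress W z.1 i j * pd j (η z.2 i) z.1
      + (∑ k, pd k (W k) z.1) * ∑ i, pd i (η z.2 i) z.1
      - ∑ i, curlFlux V z.1 i * η z.2 i z.1 := ⟨_, rfl⟩
  obtain ⟨I₃, hI₃⟩ : ∃ I : EuclideanSpace ℝ (Fin n) × ℝ → ℝ, I = fun z =>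
      κ z.2 * ∑ i, pd i (η z.2 i) z.1 := ⟨_, rfl⟩
  have htime := fun i => integral_smul_time_derivative (hwi i) (contDiff_infty.1 (hφi i) 1)
    (hφic i)
  have h₁ : Integrable I₁ := hI₁ ▸ integrable_finsetSum _ fun i _ => (htime i).1
  have h₂ : Integrable I₂ := by
    have hS : Continuous fun z : EuclideanSpace ℝ (Fin n) × ℝ => stress W z.1 :=
      (continuous_stress hW).comp continuous_fst
    have hSij (i j : Fin n) : Continuous fun z : EuclideanSpace ℝ (Fin n) × ℝ =>
      stress W z.1 i j := hS.matrix_elem i j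
    have hwc (i : Fin n) : Continuous fun z : EuclideanSpace ℝ (Fin n) × ℝ => curlFlux V z.1 i :=
      (hwi i).continuous.comp continuous_fst
    have hpc (k : Fin n) : Continuous fun z : EuclideanSpace ℝ (Fin n) × ℝ => pd k (W k) z.1 :=
      (hpdW k).comp continuous_fst
    have hφc' (i : Fin n) : Continuous fun z : EuclideanSpace ℝ (Fin n) × ℝ => η z.2 i z.1 :=
      (hφi i).continuous
    refine Continuous.integrable_of_hasCompactSupport ?_
      (HasCompactSupport.intro hφc.isCompact fun z hz => ?_)
    · rw [hI₂]
      exact ((continuous_finsetSum _ fun i _ => continuous_finsetSum _ fun j _ =>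
        (hSij i j).mul (hηcont i j)).add ((continuous_finsetSum _ fun k _ => hpc k).mul
        (continuous_finsetSum _ fun i _ => hηcont i i))).sub
        (continuous_finsetSum _ fun i _ => (hwc i).mul (hφc' i))
    · have h0 (i : Fin n) : η z.2 i z.1 = 0 := by
        change (φ z) i = 0
        rw [image_eq_zero_of_notMem_tsupport hz]
        rfl
      simp [hI₂, hηzero _ _ hz, h0]
  have h₃ : Integrable I₃ := by
    have hsub : Function.support I₃ ⊆ tsupport φ := fun z hz => by_contra fun h => hz (by
      simp [hI₃, hηzero _ _ h])
    have hsub' : tsupport I₃ ⊆ tsupport φ := closure_minimal hsub (isClosed_tsupport _)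
    refine Continuous.integrable_of_hasCompactSupport ?_
      (hφc.isCompact.of_isClosed_subset (isClosed_tsupport _) hsub')
    -- Outside `J` nothing is known of `κ`, but there the test field vanishes.
    refine ContinuousOn.continuous_of_tsupport_subset (s := univ ×ˢ J) ?_
      (isOpen_univ.prod hJ) (hsub'.trans hφJ)
    rw [hI₃]
    exact (hκ.comp continuousOn_snd fun z hz => hz.2).mul
      (continuous_finsetSum _ fun i _ => hηcont i i).continuousOn
  have e : ∀ z : EuclideanSpace ℝ (Fin n) × ℝ,
      (inner ℝ (z.2 • curlFlux V z.1) (fderiv ℝ φ z (0, 1))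
        + ∑ i, ∑ j, stress W z.1 i j * (fderiv ℝ φ z (EuclideanSpace.single j 1, 0)) i
        + (∑ k, pd k (W k) z.1 + κ z.2) *
          ∑ i, (fderiv ℝ φ z (EuclideanSpace.single i 1, 0)) i) = I₁ z + (I₂ z + I₃ z) := by
    intro z
    have h4 : inner ℝ (z.2 • curlFlux V z.1) (fderiv ℝ φ z (0, 1)) =
        ∑ i, z.2 * curlFlux V z.1 i * fderiv ℝ (fun z => φ z i) z (0, 1) := by
      rw [PiLp.inner_apply]
      refine Finset.sum_congr rfl fun i _ => ?_
      rw [fderiv_apply_coord (hφd z)]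
      simp [mul_comm]
    simp only [hηd, h4, hI₁, hI₂, hI₃, hη, Finset.sum_add_distrib]
    ring
  simp only [e]
  have z₁ : ∫ z, I₁ z = 0 := by
    rw [hI₁, integral_finsetSum _ fun i _ => (htime i).1]
    exact Finset.sum_eq_zero fun i _ => (htime i).2
  have z₂ : ∫ z, I₂ z = 0 := by
    rw [Measure.volume_eq_prod, integral_prod_symm _ h₂]
    have hs (t : ℝ) : ∫ x, I₂ (x, t) = 0 := by
      have := integral_stress_balance hn hW hV hWV (η := η t) (hηs t) (hηc t)
      simpa only [hI₂] using this
    simp only [hs, integral_zero]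
  have z₃ : ∫ z, I₃ z = 0 := by
    rw [Measure.volume_eq_prod, integral_prod_symm _ h₃]
    refine integral_eq_zero_of_ae (Filter.Eventually.of_forall fun t => ?_)
    simp only [hI₃, Pi.zero_apply]
    rw [integral_const_mul, integral_finsetSum]
    · rw [Finset.sum_eq_zero fun i _ => integral_pd_eq_zero (contDiff_infty.1 (hηs t i) 1)
        (hηc t i) i, mul_zero]
    · exact fun i _ => ((contDiff_infty.1 (hηs t i) 1).continuous_pd
        i).integrable_of_hasCompactSupport ((hηc t i).pd i)
  have h₂₃ : Integrable (fun z => I₂ z + I₃ z) := h₂.add h₃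
  rw [integral_add h₁ h₂₃, integral_add h₂ h₃, z₁, z₂, z₃]
  simp

end WeakForm

/-! ### The subsolution -/

theorem abs_energyDensity_smul_le {n : ℕ} (ρ t : ℝ) (w : EuclideanSpace ℝ (Fin n))
    (S : Matrix (Fin n) (Fin n) ℝ) :
    |energyDensity ρ (t • w) S| ≤
      t ^ 2 * ∑ i, ∑ j, |ρ⁻¹ * (w i * w j)| + ∑ i, ∑ j, |S i j| := by
  refine (abs_lambdaMax_le _).trans ?_
  rw [Finset.mul_sum, ← Finset.sum_add_distrib]
  refine Finset.sum_le_sum fun i _ => ?_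
  rw [Finset.mul_sum, ← Finset.sum_add_distrib]
  refine Finset.sum_le_sum fun j _ => ?_
  have e : (ρ⁻¹ • Matrix.vecMulVec (t • w).ofLp (t • w).ofLp - S) i j =
      t ^ 2 * (ρ⁻¹ * (w i * w j)) - S i j := by
    simp [Matrix.vecMulVec_apply]
    ring
  rw [e]
  refine (abs_sub _ _).trans_eq ?_
  rw [abs_mul (t ^ 2), abs_of_nonneg (sq_nonneg t)]

theorem proposition5p1 (n : ℕ) (hn : 2 ≤ n)
    (Ω Ω' : Set (EuclideanSpace ℝ (Fin n)))
    (hΩ_open : IsOpen Ω) (hΩ_bdd : Bornology.IsBounded Ω)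
    (hΩ'_open : IsOpen Ω') (hΩ'_conn : IsConnected Ω') (hΩ'_bdd : Bornology.IsBounded Ω')
    (hΩΩ' : closure Ω ⊆ Ω')
    (T : ℝ) (hT : 0 < T)
    (ρ₀ : EuclideanSpace ℝ (Fin n) → ℝ) (ρbar : ℝ)
    (hρ_smooth : ContDiff ℝ 1 ρ₀) (hρ_pos : ∀ x, 0 < ρ₀ x) (hρ_const : ∀ x ∉ Ω, ρ₀ x = ρbar)
    (p : ℝ → ℝ) (hp : ContDiff ℝ 1 (fun x => p (ρ₀ x)))
    (hcompat : ∫ x in Ω, p (ρ₀ x) = p ρbar * volume.real Ω) :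
    ∃ (U : EuclideanSpace ℝ (Fin n) → Matrix (Fin n) (Fin n) ℝ)
      (m : EuclideanSpace ℝ (Fin n) → ℝ → EuclideanSpace ℝ (Fin n)),
      -- `U` is a continuous field of traceless symmetric matrices, supported in `Ω'`
      Continuous U ∧ (∀ x, (U x).IsSymm ∧ (U x).trace = 0) ∧ tsupport U ⊆ Ω' ∧
      -- `m` is smooth in `x`, linear in `t`, supported in `Ω'` and solenoidal
      (∀ t, ContDiff ℝ ∞ (fun x => m x t)) ∧ (∀ x, IsLinearMap ℝ (m x)) ∧
      (∀ t, tsupport (fun x => m x t) ⊆ Ω') ∧ (∀ t x, divergence (fun y => m y t) x = 0) ∧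
      -- the momentum equation with `q₀ = p(ρ₀) + χ/n`, on `ℝⁿ × ℝ` for `χ` continuous on `ℝ`
      -- and on `ℝⁿ × J` for `χ` continuous on an open set `J` of times such as `(0, T)`
      (∀ (J : Set ℝ) (χ : ℝ → ℝ), IsOpen J → ContinuousOn χ J →
        WeakMomentumEquation m U (fun x t => p (ρ₀ x) + χ t / n) J) ∧
      -- `λ(t)` is finite and grows at most quadratically
      (∃ C₁ C₂ : ℝ, 0 < C₁ ∧ 0 < C₂ ∧
        ∀ t : ℝ, energySup Ω' ρ₀ m U t ≤ ENNReal.ofReal (C₁ * t ^ 2 + C₂)) ∧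
      -- the strict subsolution inequality for every continuous `χ > n λ` on `[0, T)`
      (∀ χ : ℝ → ℝ, ContinuousOn χ (Ico 0 T) →
        (∀ t ∈ Ico 0 T, n * (energySup Ω' ρ₀ m U t).toReal < χ t) →
        ∀ x, ∀ t ∈ Ico 0 T, energyDensity (ρ₀ x) (m x t) (U x) < χ t / n) := by
  have : NeZero n := ⟨by omega⟩
  have hn0 : (0 : ℝ) < n := by positivity
  -- The deviation of the pressure from its far-field value.
  set f : EuclideanSpace ℝ (Fin n) → ℝ := fun x => p (ρ₀ x) - p ρbar with hf
  have hfs : ContDiff ℝ 1 f := hp.sub contDiff_const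
  have hfz : ∀ x ∉ Ω, f x = 0 := fun x hx => by simp [hf, hρ_const x hx]
  have hft : tsupport f ⊆ closure Ω :=
    closure_mono fun x hx => by_contra fun h => hx (hfz x h)
  have hfc : HasCompactSupport f :=
    hΩ_bdd.isCompact_closure.of_isClosed_subset (isClosed_tsupport _) hft
  have hf0 : ∫ x, f x = 0 := by
    rw [← setIntegral_eq_integral_of_forall_compl_eq_zero hfz]
    have hi : IntegrableOn (fun x => p (ρ₀ x)) Ω :=
      (hp.continuous.continuousOn.integrableOn_compact hΩ_bdd.isCompact_closure).mono_set
        subset_closure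
    have hc : IntegrableOn (fun _ : EuclideanSpace ℝ (Fin n) => p ρbar) Ω :=
      integrableOn_const hΩ_bdd.measure_lt_top.ne
    rw [integral_sub hi hc, hcompat, setIntegral_const, smul_eq_mul]
    ring
  obtain ⟨A, V, hA, hAc, hAs, hV, hVc, hVs, hcomm, hdiv⟩ :=
    exists_curlFree_add_smooth hΩ'_open hΩ'_conn hfs hfc (hft.trans hΩΩ') hf0
  set W : Fin n → EuclideanSpace ℝ (Fin n) → ℝ := fun i x => A i x + V i x with hW
  have hV1 (i : Fin n) : ContDiff ℝ 1 (V i) := contDiff_infty.1 (hV i) 1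
  have hW1 (i : Fin n) : ContDiff ℝ 1 (W i) := (hA i).add (hV1 i)
  have hpdW (i j : Fin n) (x : EuclideanSpace ℝ (Fin n)) :
      pd j (W i) x = pd j (A i) x + pd j (V i) x :=
    congrFun (pd_add ((hA i).differentiable one_ne_zero) ((hV1 i).differentiable one_ne_zero) j) x
  have hWV (i j : Fin n) (x : EuclideanSpace ℝ (Fin n)) :
      pd j (W i) x = pd i (W j) x + curl V i j x := by
    rw [hpdW, hpdW, curl, hcomm i j]
    ring
  have hdivW (x : EuclideanSpace ℝ (Fin n)) : ∑ k, pd k (W k) x = f x := by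
    simp only [hpdW, hdiv]
  -- A compact set carrying all the fields.
  set K : Set (EuclideanSpace ℝ (Fin n)) := ⋃ i, (tsupport (A i) ∪ tsupport (V i)) with hK
  have hKc : IsCompact K := isCompact_iUnion fun i => (hAc i).isCompact.union (hVc i).isCompact
  have hKO : K ⊆ Ω' := iUnion_subset fun i => union_subset (hAs i) (hVs i)
  have hVK (i : Fin n) : tsupport (V i) ⊆ K :=
    subset_union_right.trans (subset_iUnion (fun i => tsupport (A i) ∪ tsupport (V i)) i)
  have hWK (i : Fin n) : tsupport (W i) ⊆ K :=
    (tsupport_add _ _).trans (subset_iUnion (fun i => tsupport (A i) ∪ tsupport (V i)) i)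
  have hU : Continuous (stress W) := continuous_stress hW1
  have hUK : tsupport (stress W) ⊆ K := tsupport_stress_subset hKc.isClosed hWK
  have hw : ContDiff ℝ ∞ (curlFlux V) := contDiff_curlFlux hV
  have hwK : tsupport (curlFlux V) ⊆ K := tsupport_curlFlux_subset hKc.isClosed hVK
  have hU0 {x : EuclideanSpace ℝ (Fin n)} (hx : x ∉ K) : stress W x = 0 :=
    image_eq_zero_of_notMem_tsupport fun h => hx (hUK h)
  have hw0 {x : EuclideanSpace ℝ (Fin n)} (hx : x ∉ K) : curlFlux V x = 0 :=
    image_eq_zero_of_notMem_tsupport fun h => hx (hwK h)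
  have hwi (i : Fin n) : Continuous fun x => curlFlux V x i :=
    (contDiff_euclidean.1 hw i).continuous
  have hρinv : Continuous fun x => (ρ₀ x)⁻¹ :=
    hρ_smooth.continuous.inv₀ fun x => (hρ_pos x).ne'
  have hbound : ∃ C₁ C₂ : ℝ, 0 < C₁ ∧ 0 < C₂ ∧ ∀ t : ℝ,
      energySup Ω' ρ₀ (fun x t => t • curlFlux V x) (stress W) t ≤
        ENNReal.ofReal (C₁ * t ^ 2 + C₂) := by
    have hP : Continuous fun x => ∑ i, ∑ j, |(ρ₀ x)⁻¹ * (curlFlux V x i * curlFlux V x j)| := by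
      fun_prop
    have hQ : Continuous fun x => ∑ i, ∑ j, |stress W x i j| :=
      continuous_finsetSum _ fun i _ => continuous_finsetSum _ fun j _ => (hU.matrix_elem i j).abs
    obtain ⟨C₁, hC₁⟩ := (HasCompactSupport.intro hKc fun x hx => by
      simp [hw0 hx]).exists_bound_of_continuous hP
    obtain ⟨C₂, hC₂⟩ := (HasCompactSupport.intro hKc fun x hx => by
      simp [hU0 hx]).exists_bound_of_continuous hQ
    refine ⟨max C₁ 1, max C₂ 1, by positivity, by positivity, fun t => ?_⟩
    rw [energySup, eLpNorm_exponent_top]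
    refine eLpNormEssSup_le_of_ae_bound (Filter.Eventually.of_forall fun x => ?_)
    rw [Real.norm_eq_abs]
    refine (abs_energyDensity_smul_le _ _ _ _).trans ?_
    rw [mul_comm _ (t ^ 2)]
    exact add_le_add (mul_le_mul_of_nonneg_left
      (((Real.le_norm_self _).trans (hC₁ x)).trans (le_max_left _ _)) (sq_nonneg t))
      (((Real.le_norm_self _).trans (hC₂ x)).trans (le_max_left _ _))
  refine ⟨stress W, fun x t => t • curlFlux V x, hU,
    fun x => ⟨isSymm_stress x, trace_stress hn x⟩, hUK.trans hKO,
    fun t => hw.const_smul t,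
    fun x => ⟨fun s t => add_smul s t _, fun c t => by simp [mul_smul]⟩,
    fun t => ?_, divergence_smul_curlFlux hV, fun J χ hJ hχ => ?_, hbound,
    fun χ _ hχ x t ht => ?_⟩
  · exact (closure_mono (Function.support_const_smul_subset t (curlFlux V))).trans
      (hwK.trans hKO)
  · have e : (fun x t => p (ρ₀ x) + χ t / n) =
        fun x t => ∑ k, pd k (W k) x + (p ρbar + χ t / n) := by
      funext x t
      rw [hdivW, hf]
      ring
    rw [e]
    exact weakMomentumEquation_stress hn hW1 hV hWV hJ (continuousOn_const.add (hχ.div_const _))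
  · obtain ⟨C₁, C₂, -, -, hC⟩ := hbound
    refine lt_of_le_of_lt ?_ ((lt_div_iff₀' hn0).2 (hχ t ht))
    by_cases hx : x ∈ K
    · refine le_eLpNorm_top_of_lowerSemicontinuous
        (e := fun x => energyDensity (ρ₀ x) (t • curlFlux V x) (stress W x)) hΩ'_open ?_
        (ne_top_of_le_ne_top ENNReal.ofReal_ne_top (hC t)) (hKO hx)
      refine lowerSemicontinuous_lambdaMax (continuous_matrix fun i j => ?_) fun x => ?_
      · have := hU.matrix_elem i j
        simp only [Matrix.sub_apply, Matrix.smul_apply, Matrix.vecMulVec_apply, smul_eq_mul,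
          PiLp.smul_apply]
        fun_prop
      · refine Matrix.IsSymm.sub (Matrix.IsSymm.smul (Matrix.IsSymm.ext fun i j => ?_) _)
          (isSymm_stress x)
        simp [Matrix.vecMulVec_apply, mul_comm]
    · -- Off `K`, and in particular off `Ω'`, both fields vanish and so does the energy density.
      refine le_trans ?_ ENNReal.toReal_nonneg
      refine (le_abs_self _).trans ((abs_energyDensity_smul_le (ρ₀ x) t (curlFlux V x)
        (stress W x)).trans_eq ?_)
      simp [hw0 hx, hU0 hx]
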